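/- A \emph{knot projection} is a generic immersed spherical curve $P$, i.e. a $C^\infty$ immersion $S^1\to S^2$ whose only multiple points are transverse double points. Its \emph{chord diagram} $CD_P$ is the circle $S^1$ in which the two preimages of each double point of $P$ are joined by a chord. Let $\otimes(P)$, $\mathrm{tr}(P)$ and $H(P)$ be the numbers of sub-chord diagrams (subsets of the chords) of $CD_P$ consisting, respectively, of two crossing chords (Gauss word $abab$), of three mutually crossing chords (Gauss word $abcabc$), and of two parallel chords together with a chord crossing both of them (Gauss word $abacbc$). Put $$\lambda(P)=\frac{3H(P)-3\,\mathrm{tr}(P)+\otimes(P)}{4}.$$ A \emph{flype} is the following local replacement. Suppose that, after identifying $S^2$ with $\mathbb R^2\cup\{\infty\}$ by a homeomorphism, $P$ meets the square $[-1,0]\times[-1,1]$ in a single crossing (two strands, one from $(-1,\tfrac12)$ to $(0,-\tfrac12)$ and one from $(-1,-\tfrac12)$ to $(0,\tfrac12)$, with exactly one double point, at which the two strands meet), and meets the square $[0,1]\times[-1,1]$ in a tangle $T$ (two strands, connecting the four points $(0,\pm\tfrac12),(1,\pm\tfrac12)$ in pairs in any way, and otherwise in the interior of the square). A knot projection $P'$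 is obtained from $P$ by a flype if, after identifying $S^2$ with $\mathbb R^2\cup\{\infty\}$ by a homeomorphism (possibly a different one), $P'$ agrees with $P$ up to parametrization outside $(-1,1)\times(-1,1)$, meets $[-1,0]\times[-1,1]$ in the image of $T$ under $(x,y)\mapsto(x-1,-y)$ (that is, $T$ turned over about the horizontal axis), and meets $[0,1]\times[-1,1]$ in a single crossing, in the same sense as above, with strands from $(0,\tfrac12)$ to $(1,-\tfrac12)$ and from $(0,-\tfrac12)$ to $(1,\tfrac12)$. \textbf{Corollary.} $\lambda$ is invariant under any flype: if a knot projection $P'$ is obtained from a knot projection $P$ by a flype, then $\lambda(P')=\lambda(P)$. -/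

import Mathlib

open Set Topology
open scoped ContDiff

/-- The unit sphere `S²` in `ℝ³`. -/
abbrev Sphere2 : Type := Metric.sphere (0 : EuclideanSpace ℝ (Fin 3)) 1

/-- A knot projection (generic immersed spherical curve): a smooth immersion of the circle
`ℝ / ℤ` into `S²` all of whose multiple points are transverse double points. -/
structure KnotProjection where
  /-- the parametrized curve -/
  curve : UnitAddCircle → Sphere2
  smooth : ContDiff ℝ ∞ (fun t : ℝ => (curve (t : UnitAddCircle) : EuclideanSpace ℝ (Fin 3)))
  immersion : ∀ t : ℝ,
    deriv (fun t : ℝ => (curve (t : UnitAddCircle) : EuclideanSpace ℝ (Fin 3))) t ≠ 0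
  transverse : ∀ s t : ℝ, (s : UnitAddCircle) ≠ (t : UnitAddCircle) →
    curve (s : UnitAddCircle) = curve (t : UnitAddCircle) →
    LinearIndependent ℝ
      ![deriv (fun t : ℝ => (curve (t : UnitAddCircle) : EuclideanSpace ℝ (Fin 3))) s,
        deriv (fun t : ℝ => (curve (t : UnitAddCircle) : EuclideanSpace ℝ (Fin 3))) t]
  no_triple : ∀ r s t : UnitAddCircle, curve r = curve s → curve s = curve t →
    r = s ∨ s = t ∨ r = t

/-- A chord diagram: finitely many chords of the circle `ℝ / ℤ`, all of whose endpoints are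
different. A chord is the unordered pair of its endpoints. -/
structure ChordDiagram where
  /-- the chords, as pairs of endpoints -/
  chords : Set (Sym2 UnitAddCircle)
  finite : chords.Finite
  not_isDiag : ∀ c ∈ chords, ¬ c.IsDiag
  disjoint : ∀ c ∈ chords, ∀ d ∈ chords, ∀ x : UnitAddCircle, x ∈ c → x ∈ d → c = d

namespace ChordDiagram

/-- The set of chords `S` is a copy of the chord diagram with Gauss word `w`: going once around
the circle (in the positive direction, from some endpoint on) one meets the endpoints
`t 0, t 1, …, t (m - 1)` of the chords in `S`, and `t i`, `t j` are joined by a chord if and only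
if the `i`-th and the `j`-th letter of `w` agree. -/
def Spells {m : ℕ} (w : Fin m → ℕ) (S : Set (Sym2 UnitAddCircle)) : Prop :=
  ∃ t : Fin m → ℝ, StrictMono t ∧ (∀ i j, t j < t i + 1) ∧
    S = {c | ∃ i j : Fin m, i < j ∧ w i = w j ∧
      c = s((t i : UnitAddCircle), (t j : UnitAddCircle))}

/-- The number of sub-chord diagrams of `D` of the type given by the Gauss word `w`. -/
noncomputable def count {m : ℕ} (w : Fin m → ℕ) (D : ChordDiagram) : ℕ :=
  {S : Set (Sym2 UnitAddCircle) | S ⊆ D.chords ∧ Spells w S}.ncard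

/-- Cross chord: two chords that cross each other. (This word and the next two are
palindromes up to renaming letters, so the direction on the circle does not matter.) -/
def crossWord : Fin 4 → ℕ := ![0, 1, 0, 1]

/-- Triple chord: three chords, any two of which cross. -/
def tripleWord : Fin 6 → ℕ := ![0, 1, 2, 0, 1, 2]

/-- H-chord: two parallel (non-crossing) chords `0` and `2` and a chord `1` crossing both. -/
def hWord : Fin 6 → ℕ := ![0, 1, 0, 2, 1, 2]

end ChordDiagram

namespace KnotProjection

/-- The pairs of preimages of the double points of `P`. -/
def chordSet (P : KnotProjection) : Set (Sym2 UnitAddCircle) :=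
  {c | ∃ s t : UnitAddCircle, s ≠ t ∧ P.curve s = P.curve t ∧ c = s(s, t)}

theorem chordSet_finite (P : KnotProjection) : P.chordSet.Finite := by
  set F : ℝ → EuclideanSpace ℝ (Fin 3) := fun t => (P.curve (t : UnitAddCircle)) with hF
  have hd : ∀ t, HasStrictDerivAt F (deriv F t) t := fun t =>
    P.smooth.contDiffAt.hasStrictDerivAt (by simp)
  have hper : ∀ (t : ℝ) (n : ℤ), F (t + n) = F t := by
    intro t n
    have : ((t + n : ℝ) : UnitAddCircle) = (t : UnitAddCircle) := by
      have := AddCircle.coe_eq_zero_iff (p := (1 : ℝ)) (x := (n : ℝ))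
      have h0 : ((n : ℝ) : UnitAddCircle) = 0 := this.2 ⟨n, by simp⟩
      rw [AddCircle.coe_add, h0, add_zero]
    simp only [hF, this]
  set K : Set (ℝ × ℝ) := {p | p ∈ Icc (0 : ℝ) 1 ×ˢ Icc (0 : ℝ) 1 ∧
    (p.1 : UnitAddCircle) ≠ (p.2 : UnitAddCircle) ∧ F p.1 = F p.2} with hK
  have hfin : K.Finite := by
    by_contra hinf
    obtain ⟨⟨s, t⟩, -, hacc⟩ := Set.Infinite.exists_accPt_of_subset_isCompact hinf
      (isCompact_Icc.prod isCompact_Icc) (fun p hp => hp.1)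
    rw [accPt_iff_frequently_nhdsNE] at hacc
    have hFc : Continuous F := P.smooth.continuous
    have hst : F s = F t := by
      have hcl : IsClosed {p : ℝ × ℝ | F p.1 = F p.2} :=
        isClosed_eq (hFc.comp continuous_fst) (hFc.comp continuous_snd)
      have := (hacc.filter_mono nhdsWithin_le_nhds).mono
        (q := fun p => p ∈ {p : ℝ × ℝ | F p.1 = F p.2}) (fun p hp => hp.2.2)
      exact hcl.mem_of_frequently_of_tendsto this Filter.tendsto_id
    by_cases hne : (s : UnitAddCircle) = (t : UnitAddCircle)
    · obtain ⟨n, hn⟩ : ∃ n : ℤ, t = s + n := by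
        have h0 : ((t - s : ℝ) : UnitAddCircle) = 0 := by
          rw [AddCircle.coe_sub, hne, sub_self]
        obtain ⟨n, hn⟩ := AddCircle.coe_eq_zero_iff (p := (1 : ℝ)) |>.1 h0
        exact ⟨n, by simp at hn; linarith⟩
      have hlo := (hd s).isLittleO.def (half_pos (norm_pos_iff.2 (P.immersion s)))
      have htend : Filter.Tendsto (fun p : ℝ × ℝ => (p.1, p.2 - n)) (𝓝 (s, t)) (𝓝 (s, s)) := by
        have : Continuous (fun p : ℝ × ℝ => (p.1, p.2 - (n : ℝ))) := by fun_prop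
        have h := this.tendsto (s, t)
        simpa [hn] using h
      obtain ⟨⟨u, v⟩, huv, hk⟩ :=
        ((hacc.filter_mono nhdsWithin_le_nhds).and_eventually (htend.eventually hlo)).exists
      have hv : F (v - n) = F v := by
        have := hper (v - n) n
        rw [sub_add_cancel] at this
        exact this.symm
      have huv2 : F u = F v := huv.2.2
      simp only [hv, huv2, sub_self, zero_sub, norm_neg] at hk
      have hk' : ‖u - (v - n)‖ * ‖deriv F s‖ ≤ ‖deriv F s‖ / 2 * ‖u - (v - n)‖ := by
        simpa [norm_smul] using hk
      have hpos : 0 < ‖deriv F s‖ := norm_pos_iff.2 (P.immersion s)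
      have hz : ‖u - (v - n)‖ = 0 := by
        have := norm_nonneg (u - (v - n))
        nlinarith
      have hu : v = u + n := by
        have := norm_eq_zero.1 hz
        linarith
      apply huv.2.1
      have h0 : ((n : ℝ) : UnitAddCircle) = 0 := AddCircle.coe_eq_zero_iff (p := (1 : ℝ)) |>.2
        ⟨n, by simp⟩
      simp only [hu]
      rw [AddCircle.coe_add, h0, add_zero]
    · have hli := P.transverse s t hne (Subtype.ext hst)
      have hG := ((hd s).hasDerivAt.hasFDerivAt.comp (s, t)
          (hasFDerivAt_fst (𝕜 := ℝ) (p := ((s, t) : ℝ × ℝ)))).sub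
        ((hd t).hasDerivAt.hasFDerivAt.comp (s, t)
          (hasFDerivAt_snd (𝕜 := ℝ) (p := ((s, t) : ℝ × ℝ))))
      have hanti := LinearMap.exists_antilipschitzWith
        (((ContinuousLinearMap.toSpanSingleton ℝ (deriv F s)).comp
            (ContinuousLinearMap.fst ℝ ℝ ℝ) -
          (ContinuousLinearMap.toSpanSingleton ℝ (deriv F t)).comp
            (ContinuousLinearMap.snd ℝ ℝ ℝ) : ℝ × ℝ →L[ℝ] EuclideanSpace ℝ (Fin 3)) :
              ℝ × ℝ →ₗ[ℝ] EuclideanSpace ℝ (Fin 3))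
        (by
          rw [LinearMap.ker_eq_bot']
          rintro ⟨x, y⟩ hxy
          have h := LinearIndependent.pair_iff.1 hli x (-y) (by
            have : x • deriv F s - y • deriv F t = 0 := by simpa using hxy
            rw [neg_smul, ← sub_eq_add_neg]
            exact this)
          simp [h.1, neg_eq_zero.1 h.2])
      obtain ⟨C, -, hC⟩ := hanti
      have hev := hG.eventually_ne (c := 0) ⟨C, hC⟩
      obtain ⟨p, hp, hq⟩ := (hacc.and_eventually hev).exists
      exact hq (by simpa [sub_eq_zero] using hp.2.2)
  refine (hfin.image (fun p : ℝ × ℝ =>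
    s((p.1 : UnitAddCircle), (p.2 : UnitAddCircle)))).subset ?_
  rintro c ⟨x, y, hxy, he, rfl⟩
  obtain ⟨a, ha, rfl⟩ := AddCircle.eq_coe_Ico (p := (1 : ℝ)) x
  obtain ⟨b, hb, rfl⟩ := AddCircle.eq_coe_Ico (p := (1 : ℝ)) y
  exact ⟨(a, b), ⟨⟨⟨ha.1, ha.2.le⟩, ⟨hb.1, hb.2.le⟩⟩, hxy, congrArg Subtype.val he⟩, rfl⟩

/-- The chord diagram `CD_P` of a knot projection `P`. -/
def chordDiagram (P : KnotProjection) : ChordDiagram where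
  chords := P.chordSet
  finite := P.chordSet_finite
  not_isDiag := by
    rintro c ⟨s, t, hst, -, rfl⟩
    simpa using hst
  disjoint := by
    rintro c ⟨s, t, hst, h, rfl⟩ d ⟨u, v, huv, h', rfl⟩ x hx hx'
    have key : ∀ x y z : UnitAddCircle, x ≠ y → x ≠ z → P.curve x = P.curve y →
        P.curve x = P.curve z → y = z := by
      intro x y z hxy hxz e e'
      rcases P.no_triple y x z e.symm e' with h | h | h
      · exact absurd h.symm hxy
      · exact absurd h hxz
      · exact h
    rw [Sym2.mem_iff] at hx hx'
    rcases hx with rfl | rfl <;> rcases hx' with rfl | rfl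
    · rw [key x t v hst huv h h']
    · rw [key x t u hst huv.symm h h'.symm, Sym2.eq_swap]
    · rw [key x s v hst.symm huv h.symm h', Sym2.eq_swap]
    · rw [key x s u hst.symm huv.symm h.symm h'.symm]

/-- `⊗(P)`, the number of cross chords in `CD_P`. -/
noncomputable def crossCount (P : KnotProjection) : ℕ :=
  P.chordDiagram.count ChordDiagram.crossWord

/-- `tr(P)`, the number of triple chords in `CD_P`. -/
noncomputable def tripleCount (P : KnotProjection) : ℕ :=
  P.chordDiagram.count ChordDiagram.tripleWord

/-- `H(P)`, the number of H-chords in `CD_P`. -/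
noncomputable def hCount (P : KnotProjection) : ℕ :=
  P.chordDiagram.count ChordDiagram.hWord

/-- `λ(P) = (3 H(P) - 3 tr(P) + ⊗(P)) / 4`. -/
noncomputable def lam (P : KnotProjection) : ℚ :=
  (3 * (P.hCount : ℚ) - 3 * (P.tripleCount : ℚ) + (P.crossCount : ℚ)) / 4

end KnotProjection

namespace Flype

/-- The sphere, as the plane with a point at infinity. -/
abbrev PlaneInfty : Type := OnePoint (ℝ × ℝ)

/-- A set in the plane, as a set in the sphere. -/
def inSphere (D : Set (ℝ × ℝ)) : Set PlaneInfty := (fun z : ℝ × ℝ => (z : PlaneInfty)) '' D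

/-- The box `[k, k + 1] × [-1, 1]`. -/
def box (k : ℝ) : Set (ℝ × ℝ) := Icc k (k + 1) ×ˢ Icc (-1) 1

/-- The four points where a curve enters or leaves `box k`. -/
noncomputable def nw (k : ℝ) : ℝ × ℝ := (k, 1 / 2)
/-- See `nw`. -/
noncomputable def sw (k : ℝ) : ℝ × ℝ := (k, -1 / 2)
/-- See `nw`. -/
noncomputable def ne (k : ℝ) : ℝ × ℝ := (k + 1, 1 / 2)
/-- See `nw`. -/
noncomputable def se (k : ℝ) : ℝ × ℝ := (k + 1, -1 / 2)

/-- The closed curve `γ` passes through the disk `D` in exactly two strands, traversed during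
`[a, b]` and `[c, d]`. The first strand joins the points `p` and `q`, the second joins `r` and `s`,
and apart from these end points the strands lie in the interior of `D`. -/
def Strands (γ : UnitAddCircle → PlaneInfty) (D : Set (ℝ × ℝ)) (p q r s : ℝ × ℝ)
    (a b c d : ℝ) : Prop :=
  a < b ∧ b < c ∧ c < d ∧ d < a + 1 ∧
  γ ⁻¹' inSphere D = (fun t : ℝ => (t : UnitAddCircle)) '' (Icc a b ∪ Icc c d) ∧
  (∀ t ∈ Ioo a b ∪ Ioo c d, γ (t : UnitAddCircle) ∈ inSphere (interior D)) ∧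
  s(γ (a : UnitAddCircle), γ (b : UnitAddCircle)) = s((p : PlaneInfty), (q : PlaneInfty)) ∧
  s(γ (c : UnitAddCircle), γ (d : UnitAddCircle)) = s((r : PlaneInfty), (s : PlaneInfty))

/-- The part of `γ` in `box k` is a tangle with the end points `nw k, sw k, ne k, se k`
(connected in pairs by two strands in any of the three possible ways). -/
def IsTangle (γ : UnitAddCircle → PlaneInfty) (k : ℝ) : Prop :=
  ∃ a b c d : ℝ,
    Strands γ (box k) (nw k) (ne k) (sw k) (se k) a b c d ∨
    Strands γ (box k) (nw k) (sw k) (ne k) (se k) a b c d ∨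
    Strands γ (box k) (nw k) (se k) (sw k) (ne k) a b c d

/-- The part of `γ` in `box k` is a single crossing: two strands that join opposite corners,
with exactly one double point, where the two strands meet. -/
def IsCrossing (γ : UnitAddCircle → PlaneInfty) (k : ℝ) : Prop :=
  ∃ a b c d : ℝ, Strands γ (box k) (nw k) (se k) (sw k) (ne k) a b c d ∧
    ∃ u ∈ Ioo a b, ∃ v ∈ Ioo c d, γ (u : UnitAddCircle) = γ (v : UnitAddCircle) ∧
      ∀ x y : UnitAddCircle, x ≠ y → γ x = γ y → γ x ∈ inSphere (box k) →
        γ x = γ (u : UnitAddCircle)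

/-- The part of `γ` in `A` and the part of `γ'` in `A'` agree up to parametrization,
when the former is moved by `F`. -/
def SamePart (γ γ' : UnitAddCircle → PlaneInfty) (A A' : Set PlaneInfty)
    (F : PlaneInfty → PlaneInfty) : Prop :=
  ∃ φ : UnitAddCircle → UnitAddCircle,
    BijOn φ (γ ⁻¹' A) (γ' ⁻¹' A') ∧ ContinuousOn φ (γ ⁻¹' A) ∧
      ∀ t ∈ γ ⁻¹' A, γ' (φ t) = F (γ t)

/-- The half turn of `box 0` about its horizontal axis, projected to the plane, followed by the
translation onto `box (-1)`. -/
def turn : PlaneInfty → PlaneInfty := OnePoint.map (fun z : ℝ × ℝ => (z.1 - 1, -z.2))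

/-- The standard picture of a flype. On the rectangle `[-1, 1] × [-1, 1]` the curve `γ` is a
crossing (in the left half) followed by a tangle (in the right half), and `γ'` is the tangle,
turned over about the horizontal axis, followed by a crossing.
Outside the rectangle the two curves are the same. -/
def Standard (γ γ' : UnitAddCircle → PlaneInfty) : Prop :=
  IsCrossing γ (-1) ∧ IsTangle γ 0 ∧ IsTangle γ' (-1) ∧ IsCrossing γ' 0 ∧
  SamePart γ γ' (inSphere (box 0)) (inSphere (box (-1))) turn ∧
  SamePart γ γ' (inSphere (Ioo (-1) 1 ×ˢ Ioo (-1) 1))ᶜ (inSphere (Ioo (-1) 1 ×ˢ Ioo (-1) 1))ᶜ id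

end Flype

/-- `P'` is obtained from `P` by a flype: in suitable homeomorphic pictures of the sphere as the
plane with a point at infinity, `P` and `P'` are related by the standard picture. -/
def IsFlype (P P' : KnotProjection) : Prop :=
  ∃ Φ Φ' : Sphere2 ≃ₜ Flype.PlaneInfty,
    Flype.Standard (fun t => Φ (P.curve t)) (fun t => Φ' (P'.curve t))

/-!
A flype does not change the intersection graph of the chord diagram, the graph that has the chords
as vertices and joins two chords if they cross. The three numbers of cross chords, triple chords
and H-chords are the numbers of edges, of triangles and of induced paths with three vertices of this
graph (`spells_crossWord_iff`, `spells_tripleWord_iff`, `spells_hWord_iff`), so each of them, and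
hence `λ`, is invariant (`counts_eq_of_bijOn`).

To compare the intersection graphs, start at the upper left corner of the rectangle, in the
direction of the crossing. The curve runs through six arcs: two strands `C` of the crossing, two
strands `T` of the tangle and two arcs `O` outside. Since both strands of the crossing lead from the
outside to the tangle or back, there are only three possible orders (`exists_runsThrough`), and the
flype rearranges them, read from the same corner and possibly in the reversed direction, as follows:

* `C T O C T O` becomes `T C O T C O`,
* `C T O T C O` becomes `T C O C T O`,
* `C T C O T O` becomes `T O C T C O`.

In each case the arcs `T O T O` keep their order and their directions, so the crossings between
chords other than that of the crossing `C` are preserved. A chord other than that of `C` has both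
end points in the tangle or both outside, and the chord of `C` separates the two strands of the
tangle after the move exactly if it did so before, and likewise for the two outside arcs. So the
chord of `C` crosses the same chords before and after (`cross_map_iff`).

That the rearranged arcs really are the new curve, in this order, is seen by following the arcs:
each arc of the tangle or outside is carried to an arc of the new curve, whose direction is not
known at first (`exists_isPiece_of_bijOn`). But the six corners are simple points of the curve, so
arcs that meet there have to be traversed one after the other (`IsPiece.join`), and six arcs that
close up to a cycle exhaust the curve (`IsPiece.exists_cycle`).
-/

namespace ChordDiagram

/-! ### Lifting points of the circle -/

theorem coe_add_intCast (x : ℝ) (n : ℤ) : ((x + n : ℝ) : UnitAddCircle) = x := by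
  have h : ((n : ℝ) : UnitAddCircle) = 0 :=
    AddCircle.coe_eq_zero_iff (p := (1 : ℝ)) |>.2 ⟨n, by simp⟩
  rw [AddCircle.coe_add, h, add_zero]

theorem coe_add_one (x : ℝ) : ((x + 1 : ℝ) : UnitAddCircle) = x := by
  exact_mod_cast coe_add_intCast x 1

theorem exists_int_of_coe_eq {x y : ℝ} (h : (x : UnitAddCircle) = y) : ∃ n : ℤ, y = x + n := by
  have h0 : ((y - x : ℝ) : UnitAddCircle) = 0 := by rw [AddCircle.coe_sub, h, sub_self]
  obtain ⟨n, hn⟩ := AddCircle.coe_eq_zero_iff (p := (1 : ℝ)) |>.1 h0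
  exact ⟨n, by simp at hn; linarith⟩

theorem eq_of_coe_eq {x y : ℝ} (h : (x : UnitAddCircle) = y) (h1 : x < y + 1) (h2 : y < x + 1) :
    x = y := by
  obtain ⟨n, rfl⟩ := exists_int_of_coe_eq h
  have h3 : (n : ℝ) < 1 := by linarith
  have h4 : (-1 : ℝ) < n := by linarith
  have h5 : n < 1 := by exact_mod_cast h3
  have h6 : -1 < n := by exact_mod_cast h4
  obtain rfl : n = 0 := by omega
  simp

theorem exists_lift (z : ℝ) (x : UnitAddCircle) :
    ∃ y : ℝ, z ≤ y ∧ y < z + 1 ∧ (y : UnitAddCircle) = x := by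
  induction x using QuotientAddGroup.induction_on with
  | H x => exact ⟨x + (-⌊x - z⌋ : ℤ), by push_cast; linarith [Int.floor_le (x - z)],
      by push_cast; linarith [Int.lt_floor_add_one (x - z)], coe_add_intCast _ _⟩

/-! ### Crossing chords -/

/-- The chords `c` and `d` of the circle cross each other: their end points are different and
alternate. -/
def Cross (c d : Sym2 UnitAddCircle) : Prop :=
  ∃ x u y v : ℝ, x < u ∧ u < y ∧ y < v ∧ v < x + 1 ∧
    c = s((x : UnitAddCircle), (y : UnitAddCircle)) ∧
    d = s((u : UnitAddCircle), (v : UnitAddCircle))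

theorem Cross.symm {c d : Sym2 UnitAddCircle} (h : Cross c d) : Cross d c := by
  obtain ⟨x, u, y, v, h1, h2, h3, h4, rfl, rfl⟩ := h
  exact ⟨u, y, v, x + 1, h2, h3, h4, by linarith, rfl, by rw [coe_add_one, Sym2.eq_swap]⟩

theorem Cross.neg {c d : Sym2 UnitAddCircle} (h : Cross c d) :
    Cross (c.map (fun x => -x)) (d.map (fun x => -x)) := by
  obtain ⟨x, u, y, v, h1, h2, h3, h4, rfl, rfl⟩ := h
  refine Cross.symm ⟨-v, -y, -u, -x, by linarith, by linarith, by linarith, by linarith, ?_, ?_⟩ <;>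
  simp [Sym2.eq_swap]

/-- An integer translate `Y + j` of a point `Y` slightly to the right of `X`, compared to a
translate `X + i` in the same fundamental domain. -/
theorem int_shift_cases {z X Y : ℝ} {i j : ℤ} (h1 : X < Y) (h2 : Y < X + 1) (hx : z ≤ X + i)
    (hx' : X + i < z + 1) (hy : z ≤ Y + j) (hy' : Y + j < z + 1) :
    (j : ℝ) = i ∨ (j : ℝ) = i - 1 := by
  have h3 : (i : ℝ) < j + 2 := by linarith
  have h4 : (j : ℝ) < i + 1 := by linarith
  have h5 : i < j + 2 := by exact_mod_cast h3
  have h6 : j < i + 1 := by exact_mod_cast h4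
  rcases (by omega : j = i ∨ j = i - 1) with rfl | rfl
  · simp
  · right; simp

/-- Four cyclically ordered points of the circle are met in the same order up to rotation in any
fundamental domain. -/
theorem rotation_of_coe_eq {z X U Y V x u y v : ℝ} (h1 : X < U) (h2 : U < Y) (h3 : Y < V)
    (h4 : V < X + 1) (hx : z ≤ x ∧ x < z + 1) (hu : z ≤ u ∧ u < z + 1) (hy : z ≤ y ∧ y < z + 1)
    (hv : z ≤ v ∧ v < z + 1) (e1 : (X : UnitAddCircle) = x) (e2 : (U : UnitAddCircle) = u)
    (e3 : (Y : UnitAddCircle) = y) (e4 : (V : UnitAddCircle) = v) :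
    (x < u ∧ u < y ∧ y < v) ∨ (u < y ∧ y < v ∧ v < x) ∨ (y < v ∧ v < x ∧ x < u) ∨
      (v < x ∧ x < u ∧ u < y) := by
  obtain ⟨hx, hx'⟩ := hx
  obtain ⟨hu, hu'⟩ := hu
  obtain ⟨hy, hy'⟩ := hy
  obtain ⟨hv, hv'⟩ := hv
  obtain ⟨i, rfl⟩ := exists_int_of_coe_eq e1
  obtain ⟨j, rfl⟩ := exists_int_of_coe_eq e2
  obtain ⟨k, rfl⟩ := exists_int_of_coe_eq e3
  obtain ⟨l, rfl⟩ := exists_int_of_coe_eq e4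
  rcases int_shift_cases h1 (by linarith) hx hx' hu hu' with a1 | a1 <;>
  rcases int_shift_cases (h1.trans h2) (by linarith) hx hx' hy hy' with a2 | a2 <;>
  rcases int_shift_cases (h1.trans (h2.trans h3)) h4 hx hx' hv hv' with a3 | a3 <;>
  first
  | exact Or.inl ⟨by linarith, by linarith, by linarith⟩
  | exact Or.inr (Or.inl ⟨by linarith, by linarith, by linarith⟩)
  | exact Or.inr (Or.inr (Or.inl ⟨by linarith, by linarith, by linarith⟩))
  | exact Or.inr (Or.inr (Or.inr ⟨by linarith, by linarith, by linarith⟩))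

/-- Crossing can be read off in any fundamental domain `[z, z + 1)` of the circle. -/
theorem cross_iff_of_mem_Ico {z x y u v : ℝ} (hx : z ≤ x) (hxy : x < y) (hy : y < z + 1)
    (hu : z ≤ u) (huv : u < v) (hv : v < z + 1) :
    Cross s((x : UnitAddCircle), (y : UnitAddCircle)) s((u : UnitAddCircle), (v : UnitAddCircle)) ↔
      (x < u ∧ u < y ∧ y < v) ∨ (u < x ∧ x < v ∧ v < y) := by
  have ix : z ≤ x ∧ x < z + 1 := ⟨hx, by linarith⟩
  have iy : z ≤ y ∧ y < z + 1 := ⟨by linarith, hy⟩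
  have iu : z ≤ u ∧ u < z + 1 := ⟨hu, by linarith⟩
  have iv : z ≤ v ∧ v < z + 1 := ⟨by linarith, hv⟩
  constructor
  · rintro ⟨X, U, Y, V, h1, h2, h3, h4, h5, h6⟩
    rw [Sym2.eq_iff] at h5 h6
    rcases h5 with ⟨e1, e2⟩ | ⟨e1, e2⟩ <;> rcases h6 with ⟨e3, e4⟩ | ⟨e3, e4⟩
    · rcases rotation_of_coe_eq h1 h2 h3 h4 ix iu iy iv e1.symm e3.symm e2.symm e4.symm with
        h | h | h | h <;> first | (exfalso; linarith) | exact Or.inl h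
    · rcases rotation_of_coe_eq h1 h2 h3 h4 ix iv iy iu e1.symm e4.symm e2.symm e3.symm with
        h | h | h | h <;> first | (exfalso; linarith) | exact Or.inl h | exact Or.inr h
    · rcases rotation_of_coe_eq h1 h2 h3 h4 iy iu ix iv e2.symm e3.symm e1.symm e4.symm with
        h | h | h | h <;> first | (exfalso; linarith) | exact Or.inl h | exact Or.inr h
    · rcases rotation_of_coe_eq h1 h2 h3 h4 iy iv ix iu e2.symm e4.symm e1.symm e3.symm with
        h | h | h | h <;> first | (exfalso; linarith) | exact Or.inl h
  · rintro (⟨h1, h2, h3⟩ | ⟨h1, h2, h3⟩)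
    · exact ⟨x, u, y, v, h1, h2, h3, by linarith, rfl, rfl⟩
    · exact Cross.symm ⟨u, x, v, y, h1, h2, h3, by linarith, rfl, rfl⟩

/-- A chord that crosses the chord with end points `x` and `y` has one end point in each of the two
arcs cut out by that chord. -/
theorem Cross.exists_of_lift {x y : ℝ} {d : Sym2 UnitAddCircle} (hxy : x < y) (hy : y < x + 1)
    (h : Cross s((x : UnitAddCircle), (y : UnitAddCircle)) d) :
    ∃ u v : ℝ, x < u ∧ u < y ∧ y < v ∧ v < x + 1 ∧
      d = s((u : UnitAddCircle), (v : UnitAddCircle)) := by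
  have key : ∀ u v : ℝ, x ≤ u → u < v → v < x + 1 →
      d = s((u : UnitAddCircle), (v : UnitAddCircle)) →
      ∃ u v : ℝ, x < u ∧ u < y ∧ y < v ∧ v < x + 1 ∧
        d = s((u : UnitAddCircle), (v : UnitAddCircle)) := by
    rintro u v h1 h2 h3 rfl
    rcases (cross_iff_of_mem_Ico le_rfl hxy hy h1 h2 h3).1 h with h | h
    · exact ⟨u, v, h.1, h.2.1, h.2.2, h3, rfl⟩
    · linarith
  obtain ⟨X, U, Y, V, h1, h2, h3, h4, -, rfl⟩ := h
  obtain ⟨u, hu, hu', eu⟩ := exists_lift x (U : UnitAddCircle)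
  obtain ⟨v, hv, hv', ev⟩ := exists_lift x (V : UnitAddCircle)
  rcases lt_trichotomy u v with huv | rfl | huv
  · exact key u v hu huv hv' (by rw [eu, ev])
  · linarith [eq_of_coe_eq (eu.symm.trans ev) (by linarith) (by linarith)]
  · exact key v u hv huv hu' (by rw [eu, ev, Sym2.eq_swap])

/-! ### Sub-chord diagrams in terms of crossing chords -/

theorem spells_crossWord_iff {S : Set (Sym2 UnitAddCircle)} :
    Spells crossWord S ↔ ∃ c d, Cross c d ∧ S = {c, d} := by
  constructor
  · rintro ⟨t, ht, h1, rfl⟩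
    refine ⟨s((t 0 : UnitAddCircle), (t 2 : UnitAddCircle)),
      s((t 1 : UnitAddCircle), (t 3 : UnitAddCircle)),
      ⟨t 0, t 1, t 2, t 3, ht (by decide), ht (by decide), ht (by decide), h1 _ _, rfl, rfl⟩, ?_⟩
    ext c
    constructor
    · rintro ⟨i, j, hij, hw, rfl⟩
      fin_cases i <;> fin_cases j <;> simp [crossWord] at hij hw ⊢
    · rintro (rfl | rfl)
      · exact ⟨0, 2, by decide, rfl, rfl⟩
      · exact ⟨1, 3, by decide, rfl, rfl⟩
  · rintro ⟨-, -, ⟨x, u, y, v, h1, h2, h3, h4, rfl, rfl⟩, rfl⟩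
    refine ⟨![x, u, y, v], ?_, ?_, ?_⟩
    · rw [Fin.strictMono_iff_lt_succ]
      intro i
      fin_cases i <;> assumption
    · intro i j
      fin_cases i <;> fin_cases j <;> simp <;> linarith
    · ext c
      constructor
      · rintro (rfl | rfl)
        · exact ⟨0, 2, by decide, rfl, rfl⟩
        · exact ⟨1, 3, by decide, rfl, rfl⟩
      · rintro ⟨i, j, hij, hw, rfl⟩
        fin_cases i <;> fin_cases j <;> simp [crossWord] at hij hw ⊢

theorem spells_tripleWord_iff {S : Set (Sym2 UnitAddCircle)} :
    Spells tripleWord S ↔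
      ∃ a b c, Cross a b ∧ Cross a c ∧ Cross b c ∧ S = {a, b, c} := by
  constructor
  · rintro ⟨t, ht, h1, rfl⟩
    refine ⟨s((t 0 : UnitAddCircle), (t 3 : UnitAddCircle)),
      s((t 1 : UnitAddCircle), (t 4 : UnitAddCircle)),
      s((t 2 : UnitAddCircle), (t 5 : UnitAddCircle)),
      ⟨t 0, t 1, t 3, t 4, ht (by decide), ht (by decide), ht (by decide), h1 _ _, rfl, rfl⟩,
      ⟨t 0, t 2, t 3, t 5, ht (by decide), ht (by decide), ht (by decide), h1 _ _, rfl, rfl⟩,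
      ⟨t 1, t 2, t 4, t 5, ht (by decide), ht (by decide), ht (by decide), h1 _ _, rfl, rfl⟩, ?_⟩
    ext c
    constructor
    · rintro ⟨i, j, hij, hw, rfl⟩
      fin_cases i <;> fin_cases j <;> simp [tripleWord] at hij hw ⊢
    · rintro (rfl | rfl | rfl)
      · exact ⟨0, 3, by decide, rfl, rfl⟩
      · exact ⟨1, 4, by decide, rfl, rfl⟩
      · exact ⟨2, 5, by decide, rfl, rfl⟩
  · rintro ⟨a, b, c, hab, hac, hbc, rfl⟩
    obtain ⟨x, b1, y, b2, h1, h2, h3, h4, rfl, rfl⟩ := hab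
    obtain ⟨c1, c2, g1, g2, g3, g4, rfl⟩ := hac.exists_of_lift (by linarith) (by linarith)
    have key : ∀ b1 b2 c1 c2 : ℝ, x < b1 → b1 < c1 → c1 < y → y < b2 → b2 < c2 → c2 < x + 1 →
        Spells tripleWord {s((x : UnitAddCircle), (y : UnitAddCircle)),
          s((b1 : UnitAddCircle), (b2 : UnitAddCircle)),
          s((c1 : UnitAddCircle), (c2 : UnitAddCircle))} := by
      intro b1 b2 c1 c2 k1 k2 k3 k4 k5 k6
      refine ⟨![x, b1, c1, y, b2, c2], ?_, ?_, ?_⟩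
      · rw [Fin.strictMono_iff_lt_succ]
        intro i
        fin_cases i <;> assumption
      · intro i j
        fin_cases i <;> fin_cases j <;> simp <;> linarith
      · ext c
        constructor
        · rintro (rfl | rfl | rfl)
          · exact ⟨0, 3, by decide, rfl, rfl⟩
          · exact ⟨1, 4, by decide, rfl, rfl⟩
          · exact ⟨2, 5, by decide, rfl, rfl⟩
        · rintro ⟨i, j, hij, hw, rfl⟩
          fin_cases i <;> fin_cases j <;> simp [tripleWord] at hij hw ⊢
    rcases (cross_iff_of_mem_Ico (z := x) (by linarith) (by linarith) (by linarith) (by linarith)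
      (by linarith) (by linarith)).1 hbc with h | h
    · exact key b1 b2 c1 c2 h1 h.1 g2 h3 h.2.2 g4
    · rw [Set.pair_comm s((b1 : UnitAddCircle), (b2 : UnitAddCircle))]
      exact key c1 c2 b1 b2 g1 h.1 h2 g3 h.2.2 h4

theorem spells_hWord_iff {S : Set (Sym2 UnitAddCircle)} :
    Spells hWord S ↔
      ∃ a b c, Cross b a ∧ Cross b c ∧ ¬ Cross a c ∧ (∀ x, x ∈ a → x ∉ c) ∧ S = {a, b, c} := by
  constructor
  · rintro ⟨t, ht, h1, rfl⟩
    have l1 : t 0 < t 1 := ht (by decide)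
    have l2 : t 1 < t 2 := ht (by decide)
    have l3 : t 2 < t 3 := ht (by decide)
    have l4 : t 3 < t 4 := ht (by decide)
    have l5 : t 4 < t 5 := ht (by decide)
    have l6 := h1 0 5
    refine ⟨s((t 0 : UnitAddCircle), (t 2 : UnitAddCircle)),
      s((t 1 : UnitAddCircle), (t 4 : UnitAddCircle)),
      s((t 3 : UnitAddCircle), (t 5 : UnitAddCircle)),
      Cross.symm ⟨t 0, t 1, t 2, t 4, l1, l2, by linarith, h1 _ _, rfl, rfl⟩,
      ⟨t 1, t 3, t 4, t 5, by linarith, l4, l5, h1 _ _, rfl, rfl⟩, ?_, ?_, ?_⟩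
    · rw [cross_iff_of_mem_Ico (z := t 0) (by linarith) (by linarith) (by linarith) (by linarith)
        (by linarith) (by linarith)]
      rintro (h | h) <;> linarith
    · intro x hx hx'
      rw [Sym2.mem_iff] at hx hx'
      rcases hx with rfl | rfl <;> rcases hx' with h | h <;>
        linarith [eq_of_coe_eq h (by linarith) (by linarith)]
    · ext c
      constructor
      · rintro ⟨i, j, hij, hw, rfl⟩
        fin_cases i <;> fin_cases j <;> simp [hWord] at hij hw ⊢
      · rintro (rfl | rfl | rfl)
        · exact ⟨0, 2, by decide, rfl, rfl⟩
        · exact ⟨1, 4, by decide, rfl, rfl⟩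
        · exact ⟨3, 5, by decide, rfl, rfl⟩
  · rintro ⟨a, b, c, hba, hbc, hac, hd, rfl⟩
    obtain ⟨x, a1, y, a2, h1, h2, h3, h4, rfl, rfl⟩ := hba
    obtain ⟨c1, c2, g1, g2, g3, g4, rfl⟩ := hbc.exists_of_lift (by linarith) (by linarith)
    have key : ∀ a1 a2 c1 c2 : ℝ, x < a1 → a1 < c1 → c1 < y → y < c2 → c2 < a2 → a2 < x + 1 →
        Spells hWord {s((a1 : UnitAddCircle), (a2 : UnitAddCircle)),
          s((x : UnitAddCircle), (y : UnitAddCircle)),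
          s((c1 : UnitAddCircle), (c2 : UnitAddCircle))} := by
      intro a1 a2 c1 c2 k1 k2 k3 k4 k5 k6
      have e : (a2 : UnitAddCircle) = ((a2 - 1 : ℝ) : UnitAddCircle) := by
        rw [← coe_add_one (a2 - 1), sub_add_cancel]
      rw [e, Sym2.eq_swap]
      -- The word `abacbc` is read from the last end point of `a` on.
      refine ⟨![a2 - 1, x, a1, c1, y, c2], ?_, ?_, ?_⟩
      · rw [Fin.strictMono_iff_lt_succ]
        intro i
        fin_cases i <;> simp <;> linarith
      · intro i j
        fin_cases i <;> fin_cases j <;> simp <;> linarith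
      · ext c
        constructor
        · rintro (rfl | rfl | rfl)
          · exact ⟨0, 2, by decide, rfl, rfl⟩
          · exact ⟨1, 4, by decide, rfl, rfl⟩
          · exact ⟨3, 5, by decide, rfl, rfl⟩
        · rintro ⟨i, j, hij, hw, rfl⟩
          fin_cases i <;> fin_cases j <;> simp [hWord] at hij hw ⊢
    have hd1 : a1 ≠ c1 := by
      rintro rfl
      exact hd a1 (Sym2.mem_mk_left _ _) (Sym2.mem_mk_left _ _)
    have hd2 : a2 ≠ c2 := by
      rintro rfl
      exact hd a2 (Sym2.mem_mk_right _ _) (Sym2.mem_mk_right _ _)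
    rw [cross_iff_of_mem_Ico (z := x) (by linarith) (by linarith) (by linarith) (by linarith)
      (by linarith) (by linarith)] at hac
    push Not at hac
    rcases lt_or_gt_of_ne hd1 with h | h
    · exact key a1 a2 c1 c2 h1 h g2 g3 (lt_of_le_of_ne (hac.1 h (by linarith)) hd2.symm) h4
    · have := key c1 c2 a1 a2 g1 h h2 h3 (lt_of_le_of_ne (hac.2 h (by linarith)) hd2) g4
      convert this using 1
      ext
      simp only [mem_insert_iff, mem_singleton_iff]
      tauto

theorem count_le_of_injOn {m : ℕ} {w : Fin m → ℕ} {D D' : ChordDiagram}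
    {f : Sym2 UnitAddCircle → Sym2 UnitAddCircle} (hm : MapsTo f D.chords D'.chords)
    (hi : InjOn f D.chords) (hw : ∀ S ⊆ D.chords, Spells w S → Spells w (f '' S)) :
    D.count w ≤ D'.count w := by
  refine Set.ncard_le_ncard_of_injOn (fun S => f '' S) ?_ ?_
    (D'.finite.finite_subsets.subset fun S hS => hS.1)
  · rintro S ⟨h1, h2⟩
    exact ⟨(image_mono h1).trans hm.image_subset, hw S h1 h2⟩
  · rintro S ⟨h1, -⟩ S' ⟨h1', -⟩ h
    exact (hi.image_eq_image_iff h1 h1').1 h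

theorem counts_le_of_injOn {D D' : ChordDiagram} {f : Sym2 UnitAddCircle → Sym2 UnitAddCircle}
    (hm : MapsTo f D.chords D'.chords) (hi : InjOn f D.chords)
    (hc : ∀ c ∈ D.chords, ∀ d ∈ D.chords, Cross c d ↔ Cross (f c) (f d)) :
    D.count crossWord ≤ D'.count crossWord ∧ D.count tripleWord ≤ D'.count tripleWord ∧
      D.count hWord ≤ D'.count hWord := by
  refine ⟨count_le_of_injOn hm hi ?_, count_le_of_injOn hm hi ?_, count_le_of_injOn hm hi ?_⟩
  · intro S hS h
    obtain ⟨c, d, h1, rfl⟩ := spells_crossWord_iff.1 h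
    exact spells_crossWord_iff.2 ⟨f c, f d, (hc _ (hS (by simp)) _ (hS (by simp))).1 h1,
      image_pair _ _ _⟩
  · intro S hS h
    obtain ⟨a, b, c, h1, h2, h3, rfl⟩ := spells_tripleWord_iff.1 h
    exact spells_tripleWord_iff.2 ⟨f a, f b, f c, (hc _ (hS (by simp)) _ (hS (by simp))).1 h1,
      (hc _ (hS (by simp)) _ (hS (by simp))).1 h2, (hc _ (hS (by simp)) _ (hS (by simp))).1 h3,
      by rw [image_insert_eq, image_pair]⟩
  · intro S hS h
    obtain ⟨a, b, c, h1, h2, h3, h4, rfl⟩ := spells_hWord_iff.1 h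
    have ha : a ∈ D.chords := hS (by simp)
    have hb : b ∈ D.chords := hS (by simp)
    have hc' : c ∈ D.chords := hS (by simp)
    refine spells_hWord_iff.2 ⟨f a, f b, f c, (hc _ hb _ ha).1 h1, (hc _ hb _ hc').1 h2,
      fun h => h3 ((hc _ ha _ hc').2 h), fun x hx hx' => ?_, by rw [image_insert_eq, image_pair]⟩
    obtain rfl := hi ha hc' (D'.disjoint _ (hm ha) _ (hm hc') x hx hx')
    induction a using Sym2.ind with
    | _ p q => exact h4 p (Sym2.mem_mk_left _ _) (Sym2.mem_mk_left _ _)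

/-- The three counts depend on a chord diagram only through its intersection graph, the graph
that has the chords as vertices and joins the chords that cross. -/
theorem counts_eq_of_bijOn {D D' : ChordDiagram} {f : Sym2 UnitAddCircle → Sym2 UnitAddCircle}
    (hf : BijOn f D.chords D'.chords)
    (hc : ∀ c ∈ D.chords, ∀ d ∈ D.chords, Cross c d ↔ Cross (f c) (f d)) :
    D.count crossWord = D'.count crossWord ∧ D.count tripleWord = D'.count tripleWord ∧
      D.count hWord = D'.count hWord := by
  obtain ⟨h1, h2, h3⟩ := counts_le_of_injOn hf.mapsTo hf.injOn hc
  have hg := hf.invOn_invFunOn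
  have hg' := hg.symm.bijOn hf.surjOn.mapsTo_invFunOn hf.mapsTo
  obtain ⟨h1', h2', h3'⟩ := counts_le_of_injOn hg'.mapsTo hg'.injOn (fun c hc1 d hd1 => by
    rw [hc _ (hg'.mapsTo hc1) _ (hg'.mapsTo hd1), hg.2 hc1, hg.2 hd1])
  exact ⟨h1.antisymm h1', h2.antisymm h2', h3.antisymm h3'⟩

theorem Cross.map_neg_iff {c d : Sym2 UnitAddCircle} :
    Cross (c.map (fun x => -x)) (d.map (fun x => -x)) ↔ Cross c d := by
  refine ⟨fun h => ?_, Cross.neg⟩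
  simpa [Sym2.map_map, Function.comp_def] using h.neg

/-- A chord crosses the chord with end points `u` and `v` if and only if it has exactly one end
point between `u` and `v`. -/
theorem cross_iff_mem_Ioo {z x y u v : ℝ} (hu : z ≤ u) (huv : u < v) (hv : v < z + 1)
    (hx : z ≤ x) (hxy : x < y) (hy : y < z + 1) (hxu : x ≠ u) (hxv : x ≠ v) (hyu : y ≠ u)
    (hyv : y ≠ v) :
    Cross s((u : UnitAddCircle), (v : UnitAddCircle)) s((x : UnitAddCircle), (y : UnitAddCircle)) ↔
      ¬ (x ∈ Ioo u v ↔ y ∈ Ioo u v) := by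
  rw [cross_iff_of_mem_Ico hu huv hv hx hxy hy]
  simp only [mem_Ioo]
  rcases lt_or_gt_of_ne hxu with h1 | h1 <;> rcases lt_or_gt_of_ne hxv with h2 | h2 <;>
    rcases lt_or_gt_of_ne hyu with h3 | h3 <;> rcases lt_or_gt_of_ne hyv with h4 | h4 <;>
    simp [h1, h2, h3, h4, h1.not_gt, h2.not_gt, h3.not_gt, h4.not_gt] <;> linarith

/-! ### Moving one chord -/

/-- Suppose that the chords other than `{u, v}` have their end points in four arcs, and that a map
`Φ` of the circle moves these arcs without changing their order, up to an automorphism `σ` of the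
crossing relation. If the chord `{u, v}` is moved in such a way that it separates two arcs that
are joined by chords after the move exactly if it did so before, then `Φ` preserves crossings.

The map `h i` is a lift of `σ ∘ Φ` to the `i`-th arc, `J i j` says that chords may join the arcs
`i` and `j`, and `k i` and `k' i` say that the `i`-th arc lies between the end points of the chord
`{u, v}` before and after the move. -/
theorem cross_map_iff {C : Set (Sym2 UnitAddCircle)} {Φ σ : UnitAddCircle → UnitAddCircle}
    (hσ : ∀ c d, Cross (c.map σ) (d.map σ) ↔ Cross c d)
    {z z' u v u' v' : ℝ} {l r : Fin 4 → ℝ} {h : Fin 4 → ℝ → ℝ} {k k' : Fin 4 → Prop}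
    (hu : z ≤ u) (huv : u < v) (hv : v < z + 1)
    (hu' : z' ≤ u') (huv' : u' < v') (hv' : v' < z' + 1)
    (hl : ∀ i, z ≤ l i) (hr : ∀ i, r i ≤ z + 1) (hlr : ∀ i j, i < j → r i ≤ l j)
    (hl' : ∀ i, z' ≤ h i (l i)) (hr' : ∀ i, h i (r i) ≤ z' + 1)
    (hlr' : ∀ i j, i < j → h i (r i) ≤ h j (l j))
    (hmono : ∀ i, StrictMonoOn (h i) (Icc (l i) (r i)))
    (hΦ : ∀ i, ∀ x ∈ Ioo (l i) (r i), (h i x : UnitAddCircle) = σ (Φ x))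
    (hΦu : (u' : UnitAddCircle) = σ (Φ u)) (hΦv : (v' : UnitAddCircle) = σ (Φ v))
    (hk : ∀ i, ∀ x ∈ Ioo (l i) (r i), x ≠ u ∧ x ≠ v ∧ (x ∈ Ioo u v ↔ k i))
    (hk' : ∀ i, ∀ x ∈ Ioo (l i) (r i), h i x ≠ u' ∧ h i x ≠ v' ∧ (h i x ∈ Ioo u' v' ↔ k' i))
    {J : Fin 4 → Fin 4 → Prop} (hJ : ∀ i j, J i j → ((k i ↔ k j) ↔ (k' i ↔ k' j)))
    (hC : ∀ c ∈ C, c = s((u : UnitAddCircle), (v : UnitAddCircle)) ∨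
      ∃ i j, J i j ∧ ∃ x ∈ Ioo (l i) (r i), ∃ y ∈ Ioo (l j) (r j), x < y ∧
        c = s((x : UnitAddCircle), (y : UnitAddCircle))) :
    ∀ c ∈ C, ∀ d ∈ C, Cross c d ↔ Cross (c.map Φ) (d.map Φ) := by
  have hlt' : ∀ i, ∀ x ∈ Ioo (l i) (r i), h i (l i) < h i x ∧ h i x < h i (r i) := fun i x hx =>
    have hlr := (hx.1.trans hx.2).le
    ⟨hmono i (left_mem_Icc.2 hlr) (Ioo_subset_Icc_self hx) hx.1,
      hmono i (Ioo_subset_Icc_self hx) (right_mem_Icc.2 hlr) hx.2⟩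
  have hlt : ∀ i j, ∀ x ∈ Ioo (l i) (r i), ∀ y ∈ Ioo (l j) (r j), x < y → h i x < h j y := by
    intro i j x hx y hy hxy
    rcases lt_trichotomy i j with hij | rfl | hij
    · linarith [(hlt' i x hx).2, (hlt' j y hy).1, hlr' i j hij]
    · exact hmono i (Ioo_subset_Icc_self hx) (Ioo_subset_Icc_self hy) hxy
    · linarith [hx.1, hy.2, hlr j i hij]
  have hiff : ∀ i j, ∀ x ∈ Ioo (l i) (r i), ∀ y ∈ Ioo (l j) (r j), h i x < h j y ↔ x < y := by
    intro i j x hx y hy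
    refine ⟨fun hh => ?_, hlt i j x hx y hy⟩
    rcases lt_trichotomy x y with hxy | rfl | hxy
    · exact hxy
    · rcases lt_trichotomy i j with hij | rfl | hij
      · linarith [hx.2, hy.1, hlr i j hij]
      · exact absurd hh (lt_irrefl _)
      · linarith [hx.1, hy.2, hlr j i hij]
    · exact absurd hh (hlt j i y hy x hx hxy).not_gt
  have hsep : ∀ i j x y, J i j → x ∈ Ioo (l i) (r i) → y ∈ Ioo (l j) (r j) → x < y →
      (Cross s((u : UnitAddCircle), (v : UnitAddCircle))
          s((x : UnitAddCircle), (y : UnitAddCircle)) ↔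
        Cross s((u' : UnitAddCircle), (v' : UnitAddCircle))
          s((h i x : UnitAddCircle), (h j y : UnitAddCircle))) := by
    intro i j x y hij hx hy hxy
    obtain ⟨x1, x2, x3⟩ := hk i x hx
    obtain ⟨y1, y2, y3⟩ := hk j y hy
    obtain ⟨x1', x2', x3'⟩ := hk' i x hx
    obtain ⟨y1', y2', y3'⟩ := hk' j y hy
    rw [cross_iff_mem_Ioo hu huv hv ((hl i).trans hx.1.le) hxy (hy.2.trans_le (hr j)) x1 x2 y1 y2,
      cross_iff_mem_Ioo hu' huv' hv' ((hl' i).trans (hlt' i x hx).1.le) (hlt i j x hx y hy hxy)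
        ((hlt' j y hy).2.trans_le (hr' j)) x1' x2' y1' y2', x3, y3, x3', y3', hJ i j hij]
  intro c hc d hd
  rw [← hσ (c.map Φ) (d.map Φ)]
  rcases hC c hc with rfl | ⟨i, j, hij, x, hx, y, hy, hxy, rfl⟩ <;>
    rcases hC d hd with rfl | ⟨i', j', hij', x', hx', y', hy', hxy', rfl⟩
  · simp only [Sym2.map_mk, ← hΦu, ← hΦv, cross_iff_of_mem_Ico hu huv hv hu huv hv,
      cross_iff_of_mem_Ico hu' huv' hv' hu' huv' hv', lt_irrefl, and_false]
  · simp only [Sym2.map_mk, ← hΦu, ← hΦv, ← hΦ _ _ hx', ← hΦ _ _ hy']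
    exact hsep _ _ _ _ hij' hx' hy' hxy'
  · simp only [Sym2.map_mk, ← hΦu, ← hΦv, ← hΦ _ _ hx, ← hΦ _ _ hy]
    exact ⟨fun H => ((hsep _ _ _ _ hij hx hy hxy).1 H.symm).symm,
      fun H => ((hsep _ _ _ _ hij hx hy hxy).2 H.symm).symm⟩
  · simp only [Sym2.map_mk, ← hΦ _ _ hx, ← hΦ _ _ hy, ← hΦ _ _ hx', ← hΦ _ _ hy']
    rw [cross_iff_of_mem_Ico ((hl i).trans hx.1.le) hxy (hy.2.trans_le (hr j))
        ((hl i').trans hx'.1.le) hxy' (hy'.2.trans_le (hr j')),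
      cross_iff_of_mem_Ico ((hl' i).trans (hlt' i x hx).1.le) (hlt i j x hx y hy hxy)
        ((hlt' j y hy).2.trans_le (hr' j)) ((hl' i').trans (hlt' i' x' hx').1.le)
        (hlt i' j' x' hx' y' hy' hxy') ((hlt' j' y' hy').2.trans_le (hr' j')),
      hiff _ _ _ hx _ hx', hiff _ _ _ hx' _ hy, hiff _ _ _ hy _ hy', hiff _ _ _ hx' _ hx,
      hiff _ _ _ hx _ hy', hiff _ _ _ hy' _ hy]

end ChordDiagram

open ChordDiagram

/-! ### Double points and arcs of closed curves -/

/-- The pairs of parameters at which a closed curve passes through the same point. -/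
def doublePairs {X : Type*} (γ : UnitAddCircle → X) : Set (Sym2 UnitAddCircle) :=
  {c | ∃ s t : UnitAddCircle, s ≠ t ∧ γ s = γ t ∧ c = s(s, t)}

/-- A map of the circle induces a bijection of double points if it maps pairs to pairs and is
injective and surjective on the parameters that occur in them. -/
theorem bijOn_map_doublePairs {X : Type*} {γ γ' : UnitAddCircle → X}
    {Φ : UnitAddCircle → UnitAddCircle}
    (hm : ∀ x y, x ≠ y → γ x = γ y → Φ x ≠ Φ y ∧ γ' (Φ x) = γ' (Φ y))
    (hi : ∀ x y x' y', x ≠ y → γ x = γ y → x' ≠ y' → γ x' = γ y' → Φ x = Φ x' → x = x')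
    (hs : ∀ x' y', x' ≠ y' → γ' x' = γ' y' → ∃ x y, x ≠ y ∧ γ x = γ y ∧ s(Φ x, Φ y) = s(x', y')) :
    BijOn (Sym2.map Φ) (doublePairs γ) (doublePairs γ') := by
  refine ⟨?_, ?_, ?_⟩
  · rintro _ ⟨x, y, hxy, h, rfl⟩
    exact ⟨Φ x, Φ y, (hm x y hxy h).1, (hm x y hxy h).2, rfl⟩
  · rintro _ ⟨x, y, hxy, h, rfl⟩ _ ⟨x', y', hxy', h', rfl⟩ he
    rw [Sym2.map_mk, Sym2.map_mk, Sym2.eq_iff] at he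
    rw [Sym2.eq_iff]
    rcases he with ⟨e1, e2⟩ | ⟨e1, e2⟩
    · exact Or.inl ⟨hi _ _ _ _ hxy h hxy' h' e1, hi _ _ _ _ hxy.symm h.symm hxy'.symm h'.symm e2⟩
    · exact Or.inr ⟨hi _ _ _ _ hxy h hxy'.symm h'.symm e1, hi _ _ _ _ hxy.symm h.symm hxy' h' e2⟩
  · rintro _ ⟨x', y', hxy', h', rfl⟩
    obtain ⟨x, y, hxy, h, e⟩ := hs x' y' hxy' h'
    exact ⟨s(x, y), ⟨x, y, hxy, h, rfl⟩, e⟩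

/-- A partial lift to `ℝ` of a continuous injective map of an arc to the circle that is not
surjective. -/
theorem exists_lift_of_continuousOn {φ : UnitAddCircle → UnitAddCircle} {s t : ℝ} (hst : t < s + 1)
    {A : Set UnitAddCircle} (hA : ∀ x ∈ Icc s t, (x : UnitAddCircle) ∈ A)
    (hc : ContinuousOn φ A) (hi : InjOn φ A) {z : UnitAddCircle} (hz : z ∉ φ '' A) :
    ∃ g : ℝ → ℝ, ContinuousOn g (Icc s t) ∧ InjOn g (Icc s t) ∧
      ∀ x, (g x : UnitAddCircle) = φ x := by
  obtain ⟨z0, -, -, rfl⟩ := exists_lift 0 z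
  refine ⟨fun x => (AddCircle.equivIco 1 z0 (φ x) : ℝ), ?_, ?_, fun x => AddCircle.coe_equivIco⟩
  · intro x hx
    have h1 : ContinuousWithinAt (fun x : ℝ => φ x) (Icc s t) x :=
      ContinuousWithinAt.comp (t := A) (hc _ (hA x hx))
        (AddCircle.continuous_mk' 1).continuousWithinAt (fun y hy => hA y hy)
    have h2 : φ x ≠ z0 := fun h => hz ⟨x, hA x hx, h⟩
    exact ContinuousAt.comp_continuousWithinAt (f := fun x : ℝ => φ x)
      (g := fun y => (AddCircle.equivIco 1 z0 y : ℝ))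
      (continuous_subtype_val.continuousAt.comp (AddCircle.continuousAt_equivIco 1 z0 h2)) h1
  · intro x hx y hy h
    have h1 : φ x = φ y := (AddCircle.equivIco 1 z0).injective (Subtype.ext h)
    exact eq_of_coe_eq (hi (hA x hx) (hA y hy) h1) (by linarith [hx.2, hy.1])
      (by linarith [hx.1, hy.2])

/-- The curve `γ`, reparametrized on `[s, t]` by the continuous injective function `g`, leads from
`p` to `q` through the region `I`. The function `g` may reverse the direction. -/
structure IsPiece {X : Type*} (γ : UnitAddCircle → X) (I : Set X) (p q : X) (g : ℝ → ℝ)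
    (s t : ℝ) : Prop where
  lt : s < t
  cont : ContinuousOn g (Icc s t)
  inj : InjOn g (Icc s t)
  left : γ (g s) = p
  right : γ (g t) = q
  mem : ∀ x ∈ Ioo s t, γ (g x) ∈ I

namespace IsPiece

variable {X : Type*} {γ : UnitAddCircle → X} {I J : Set X} {p q r : X} {g k : ℝ → ℝ} {s t s' t' : ℝ}

theorem strictMonoOn_or_strictAntiOn (h : IsPiece γ I p q g s t) :
    StrictMonoOn g (Icc s t) ∨ StrictAntiOn g (Icc s t) :=
  h.cont.strictMonoOn_of_injOn_Icc' h.lt.le h.inj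

theorem neg (h : IsPiece γ I p q g s t) :
    IsPiece (fun x => γ (-x)) I p q (fun x => -g x) s t where
  lt := h.lt
  cont := h.cont.neg
  inj := fun _ hx _ hy e => h.inj hx hy (neg_injective e)
  left := by simpa using h.left
  right := by simpa using h.right
  mem := by simpa using h.mem

theorem reverse (h : IsPiece γ I p q g s t) : IsPiece γ I q p (fun x => g (-x)) (-t) (-s) where
  lt := neg_lt_neg h.lt
  cont := h.cont.comp continuous_neg.continuousOn
    (fun x hx => ⟨by linarith [hx.2], by linarith [hx.1]⟩)
  inj := fun x hx y hy e => neg_injective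
    (h.inj ⟨by linarith [hx.2], by linarith [hx.1]⟩ ⟨by linarith [hy.2], by linarith [hy.1]⟩ e)
  left := by simpa using h.right
  right := by simpa using h.left
  mem := fun x hx => h.mem (-x) ⟨by linarith [hx.2], by linarith [hx.1]⟩

theorem lt_of_strictMonoOn (h : IsPiece γ I p q g s t) (hg : StrictMonoOn g (Icc s t)) :
    g s < g t := hg (left_mem_Icc.2 h.lt.le) (right_mem_Icc.2 h.lt.le) h.lt

theorem mem_of_mem_Ioo (h : IsPiece γ I p q g s t) {y : ℝ} (hy : y ∈ Ioo (g s) (g t)) :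
    γ y ∈ I := by
  obtain ⟨x, hx, rfl⟩ := intermediate_value_Ioo h.lt.le h.cont hy
  exact h.mem x hx

/-- Two arcs of `γ` in disjoint regions do not arrive at the same simple point. -/
theorem false_of_right_eq {a b a' b' : ℝ} (hab : a < b) (hab' : a' < b')
    (hI : ∀ x ∈ Ioo a b, γ x ∈ I) (hJ : ∀ x ∈ Ioo a' b', γ x ∈ J) (hd : Disjoint I J)
    (h : (b : UnitAddCircle) = b') : False := by
  obtain ⟨n, rfl⟩ := exists_int_of_coe_eq h
  obtain ⟨y, h1, h2⟩ := exists_between (max_lt hab (by linarith : a' - n < b))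
  have h3 := (le_max_left _ _).trans_lt h1
  have h4 := (le_max_right _ _).trans_lt h1
  refine Set.disjoint_left.1 hd (hI y ⟨h3, h2⟩) ?_
  rw [← coe_add_intCast y n]
  exact hJ _ ⟨by linarith, by linarith⟩

/-- If two pieces in disjoint regions are joined at a simple point of the curve, then they have
the same direction. -/
theorem join (h : IsPiece γ I p q g s t) (h' : IsPiece γ J q r k s' t') (hd : Disjoint I J)
    (hq : ∀ x y, γ x = q → γ y = q → x = y) (hg : StrictMonoOn g (Icc s t)) :
    StrictMonoOn k (Icc s' t') ∧ ∃ n : ℤ, g t = k s' + n := by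
  have he : (k s' : UnitAddCircle) = g t := hq _ _ h'.left h.right
  refine ⟨h'.strictMonoOn_or_strictAntiOn.resolve_right fun hk => ?_, exists_int_of_coe_eq he⟩
  have hlt : k t' < k s' := hk (left_mem_Icc.2 h'.lt.le) (right_mem_Icc.2 h'.lt.le) h'.lt
  refine false_of_right_eq (h.lt_of_strictMonoOn hg) hlt (fun x hx => h.mem_of_mem_Ioo hx)
    (fun x hx => ?_) hd he.symm
  obtain ⟨y, hy, rfl⟩ := intermediate_value_Ioo' h'.lt.le h'.cont hx
  exact h'.mem y hy

/-- Six pieces that are joined to a closed cycle at six simple points of the curve have the same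
direction, and together they run through the curve exactly once. -/
theorem exists_cycle {g : Fin 6 → ℝ → ℝ} {s t : Fin 6 → ℝ} {I : Fin 6 → Set X} {w : Fin 6 → X}
    (h : ∀ i, IsPiece γ (I i) (w i) (w (i + 1)) (g i) (s i) (t i))
    (hd : ∀ i, Disjoint (I i) (I (i + 1))) (hw : ∀ i x y, γ x = w i → γ y = w i → x = y)
    (hwi : ∀ i, i ≠ 0 → w i ≠ w 0) (hwI : ∀ i, w 0 ∉ I i) :
    ∃ σ : UnitAddCircle → UnitAddCircle, (σ = id ∨ σ = fun x => -x) ∧ ∃ k : Fin 6 → ℝ → ℝ,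
      (∀ i x, (k i x : UnitAddCircle) = σ (g i x)) ∧
      (∀ i, StrictMonoOn (k i) (Icc (s i) (t i))) ∧
      (∀ i j, i < j → k i (t i) ≤ k j (s j)) ∧
      (∀ i, k 0 (s 0) ≤ k i (s i)) ∧ (∀ i, k i (t i) ≤ k 0 (s 0) + 1) := by
  -- After reversing the curve if necessary, the first piece runs forwards, and so do all others.
  wlog hg : StrictMonoOn (g 0) (Icc (s 0) (t 0)) generalizing γ g
  · have hg' := (h 0).strictMonoOn_or_strictAntiOn.resolve_left hg
    obtain ⟨σ, hσ, k, hk, hk'⟩ := this (γ := fun x => γ (-x)) (g := fun i x => -g i x)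
      (fun i => (h i).neg) (fun i x y hx hy => neg_injective (hw i _ _ hx hy)) hg'.neg
    refine ⟨fun x => σ (-x), ?_, k, fun i x => by simpa using hk i x, hk'⟩
    rcases hσ with rfl | rfl
    · exact Or.inr rfl
    · left; ext x; simp
  have step : ∀ i, StrictMonoOn (g i) (Icc (s i) (t i)) →
      StrictMonoOn (g (i + 1)) (Icc (s (i + 1)) (t (i + 1))) ∧
        ∃ n : ℤ, g i (t i) = g (i + 1) (s (i + 1)) + n := fun i hi =>
    (h i).join (h (i + 1)) (hd i) (hw (i + 1)) hi
  obtain ⟨m1, n0, e0⟩ := step 0 hg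
  obtain ⟨m2, n1, e1⟩ := step 1 m1
  obtain ⟨m3, n2, e2⟩ := step 2 m2
  obtain ⟨m4, n3, e3⟩ := step 3 m3
  obtain ⟨m5, n4, e4⟩ := step 4 m4
  obtain ⟨-, n5, e5⟩ := step 5 m5
  have hm : ∀ i, StrictMonoOn (g i) (Icc (s i) (t i)) := by
    intro i
    fin_cases i <;> assumption
  have hlt : ∀ i, g i (s i) < g i (t i) := fun i => (h i).lt_of_strictMonoOn (hm i)
  -- Translating the pieces by `n i` makes each of them start where the previous one ends.
  set n : Fin 6 → ℤ := ![0, n0, n0 + n1, n0 + n1 + n2, n0 + n1 + n2 + n3, n0 + n1 + n2 + n3 + n4]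
    with hn
  have v0 : n 0 = 0 := rfl
  have v1 : n 1 = n0 := rfl
  have v2 : n 2 = n0 + n1 := rfl
  have v3 : n 3 = n0 + n1 + n2 := rfl
  have v4 : n 4 = n0 + n1 + n2 + n3 := rfl
  have v5 : n 5 = n0 + n1 + n2 + n3 + n4 := rfl
  clear_value n
  obtain ⟨Q, hQ⟩ : ∃ Q : Fin 6 → ℝ, ∀ i, Q i = g i (s i) + n i := ⟨_, fun i => rfl⟩
  obtain ⟨R, hR⟩ : ∃ R : Fin 6 → ℝ, ∀ i, R i = g i (t i) + n i := ⟨_, fun i => rfl⟩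
  have hQR : ∀ i, Q i < R i := fun i => by rw [hQ, hR]; linarith [hlt i]
  have r0 : R 0 = Q 1 := by rw [hQ, hR, e0, v0, v1, Int.cast_zero, add_zero]; rfl
  have r1 : R 1 = Q 2 := by rw [hQ, hR, e1, v1, v2]; push_cast; rw [add_assoc, add_comm (n1 : ℝ)]
  have r2 : R 2 = Q 3 := by rw [hQ, hR, e2, v2, v3]; push_cast; rw [add_assoc, add_comm (n2 : ℝ)]
  have r3 : R 3 = Q 4 := by rw [hQ, hR, e3, v3, v4]; push_cast; rw [add_assoc, add_comm (n3 : ℝ)]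
  have r4 : R 4 = Q 5 := by rw [hQ, hR, e4, v4, v5]; push_cast; rw [add_assoc, add_comm (n4 : ℝ)]
  have r5 : R 5 = Q 0 + ((n5 + n 5 : ℤ) : ℝ) := by
    rw [hQ, hR, e5, v0, Int.cast_zero, add_zero]; push_cast; rw [add_assoc]
  -- A longer cycle would pass through the simple point `w 0` at the parameter `Q 0 + 1`.
  have hN : n5 + n 5 = 1 := by
    have h0 : (0 : ℝ) < ((n5 + n 5 : ℤ) : ℝ) := by
      linarith [hQR 0, hQR 1, hQR 2, hQR 3, hQR 4, hQR 5]
    have h0' : 0 < n5 + n 5 := by exact_mod_cast h0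
    by_contra hne
    have h2 : (2 : ℝ) ≤ ((n5 + n 5 : ℤ) : ℝ) := by exact_mod_cast (by omega : 2 ≤ n5 + n 5)
    have hy : γ ((Q 0 + 1 : ℝ) : UnitAddCircle) = w 0 := by
      rw [coe_add_one, hQ, coe_add_intCast, (h 0).left]
    obtain ⟨i, hi, hi'⟩ : ∃ i, Q i ≤ Q 0 + 1 ∧ Q 0 + 1 < R i := by
      by_contra hcon
      push Not at hcon
      have c0 := hcon 0 (by linarith)
      have c1 := hcon 1 (by linarith)
      have c2 := hcon 2 (by linarith)
      have c3 := hcon 3 (by linarith)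
      have c4 := hcon 4 (by linarith)
      have c5 := hcon 5 (by linarith)
      linarith
    rcases hi.eq_or_lt with he | hi
    · refine hwi i (by rintro rfl; linarith) ?_
      rw [← hy, ← he, hQ, coe_add_intCast, (h i).left]
    · refine hwI i ?_
      rw [← hy, ← sub_add_cancel (Q 0 + 1) (n i : ℝ), coe_add_intCast]
      exact (h i).mem_of_mem_Ioo ⟨by linarith [hQ i], by linarith [hR i]⟩
  rw [hN, Int.cast_one] at r5
  refine ⟨id, Or.inl rfl, fun i x => g i x + n i, fun i x => coe_add_intCast _ _,
    fun i x hx y hy hxy => add_lt_add_left (hm i hx hy hxy) _, ?_, ?_, ?_⟩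
  · intro i j hij
    simp only [← hQ, ← hR]
    have := hQR 0
    have := hQR 1
    have := hQR 2
    have := hQR 3
    have := hQR 4
    have := hQR 5
    fin_cases i <;> fin_cases j <;> first | (exfalso; revert hij; decide) | (simp; linarith)
  · intro i
    simp only [← hQ]
    have := hQR 0
    have := hQR 1
    have := hQR 2
    have := hQR 3
    have := hQR 4
    have := hQR 5
    fin_cases i <;> simp <;> linarith
  · intro i
    simp only [← hQ, ← hR]
    have := hQR 0
    have := hQR 1
    have := hQR 2
    have := hQR 3
    have := hQR 4
    have := hQR 5
    fin_cases i <;> simp <;> linarith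

end IsPiece

namespace Flype

/-! ### The two boxes and their corners -/

theorem coe_mem_inSphere {D : Set (ℝ × ℝ)} {z : ℝ × ℝ} : (z : PlaneInfty) ∈ inSphere D ↔ z ∈ D :=
  OnePoint.coe_injective.mem_set_image

theorem inSphere_mono {D D' : Set (ℝ × ℝ)} (h : D ⊆ D') : inSphere D ⊆ inSphere D' := image_mono h

theorem interior_box (k : ℝ) : interior (box k) = Ioo k (k + 1) ×ˢ Ioo (-1) 1 := by
  rw [box, interior_prod_eq, interior_Icc, interior_Icc]

/-- The interior of a box, as a set in the sphere. -/
def inner (k : ℝ) : Set PlaneInfty := inSphere (interior (box k))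

/-- The complement of the two boxes. -/
def outside : Set PlaneInfty := (inSphere (box (-1)) ∪ inSphere (box 0))ᶜ

theorem inner_subset (k : ℝ) : inner k ⊆ inSphere (box k) := inSphere_mono interior_subset

theorem coe_mem_inner {k : ℝ} {z : ℝ × ℝ} :
    (z : PlaneInfty) ∈ inner k ↔ (k < z.1 ∧ z.1 < k + 1) ∧ -1 < z.2 ∧ z.2 < 1 := by
  rw [inner, coe_mem_inSphere, interior_box]
  rfl

theorem coe_mem_box {k : ℝ} {z : ℝ × ℝ} :
    (z : PlaneInfty) ∈ inSphere (box k) ↔ (k ≤ z.1 ∧ z.1 ≤ k + 1) ∧ -1 ≤ z.2 ∧ z.2 ≤ 1 := by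
  rw [coe_mem_inSphere]
  rfl

theorem inner_disjoint_box : Disjoint (inner (-1)) (inSphere (box 0)) := by
  rw [Set.disjoint_left]
  rintro _ ⟨z, hz, rfl⟩ h
  rw [interior_box] at hz
  have h1 := (coe_mem_box.1 h).1.1
  have h2 := hz.1.2
  linarith

theorem inner_disjoint_box' : Disjoint (inner 0) (inSphere (box (-1))) := by
  rw [Set.disjoint_left]
  rintro _ ⟨z, hz, rfl⟩ h
  rw [interior_box] at hz
  have h1 := (coe_mem_box.1 h).1.2
  have h2 := hz.1.1
  linarith

theorem inner_disjoint_inner : Disjoint (inner (-1)) (inner 0) :=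
  inner_disjoint_box.mono_right (inner_subset 0)

theorem inner_disjoint_outside : Disjoint (inner (-1)) outside :=
  Set.disjoint_left.2 fun _ h h' => h' (Or.inl (inner_subset _ h))

theorem inner_disjoint_outside' : Disjoint (inner 0) outside :=
  Set.disjoint_left.2 fun _ h h' => h' (Or.inr (inner_subset _ h))

theorem ne_neg_one : ne (-1) = nw 0 := by norm_num [ne, nw]

theorem se_neg_one : se (-1) = sw 0 := by norm_num [se, sw]

/-- The six points where a curve may enter or leave one of the two boxes. -/
def corners : Set (ℝ × ℝ) := {nw (-1), sw (-1), nw 0, sw 0, ne 0, se 0}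

theorem not_mem_inner_of_mem_corners {p : ℝ × ℝ} (hp : p ∈ corners) {k : ℝ} (hk : k = -1 ∨ k = 0) :
    (p : PlaneInfty) ∉ inner k := by
  rw [coe_mem_inner]
  rcases hp with rfl | rfl | rfl | rfl | rfl | rfl <;> rcases hk with rfl | rfl <;>
    norm_num [nw, sw, ne, se]

theorem not_mem_outside_of_mem_corners {p : ℝ × ℝ} (hp : p ∈ corners) :
    (p : PlaneInfty) ∉ outside := by
  rw [outside, notMem_compl_iff, mem_union, coe_mem_box, coe_mem_box]
  rcases hp with rfl | rfl | rfl | rfl | rfl | rfl <;> norm_num [nw, sw, ne, se]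

variable {γ : UnitAddCircle → PlaneInfty} {D : Set (ℝ × ℝ)} {p q r s : ℝ × ℝ} {a b c d : ℝ}

/-! ### Strands of a curve in a disk -/

namespace Strands

theorem symm_left (h : Strands γ D p q r s a b c d) : Strands γ D q p r s a b c d := by
  obtain ⟨h1, h2, h3, h4, h5, h6, h7, h8⟩ := h
  exact ⟨h1, h2, h3, h4, h5, h6, by rw [h7, Sym2.eq_swap], h8⟩

theorem shift (h : Strands γ D p q r s a b c d) (n : ℤ) :
    Strands γ D p q r s (a + n) (b + n) (c + n) (d + n) := by
  obtain ⟨h1, h2, h3, h4, h5, h6, h7, h8⟩ := h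
  refine ⟨by linarith, by linarith, by linarith, by linarith, ?_, ?_, ?_, ?_⟩
  · rw [h5]
    ext x
    constructor
    · rintro ⟨t, ht | ht, rfl⟩
      · exact ⟨t + n, Or.inl ⟨by linarith [ht.1], by linarith [ht.2]⟩, coe_add_intCast _ _⟩
      · exact ⟨t + n, Or.inr ⟨by linarith [ht.1], by linarith [ht.2]⟩, coe_add_intCast _ _⟩
    · rintro ⟨t, ht | ht, rfl⟩
      · refine ⟨t - n, Or.inl ⟨by linarith [ht.1], by linarith [ht.2]⟩, ?_⟩
        simp
      · refine ⟨t - n, Or.inr ⟨by linarith [ht.1], by linarith [ht.2]⟩, ?_⟩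
        simp
  · intro t ht
    rw [← sub_add_cancel t (n : ℝ), coe_add_intCast]
    apply h6
    rcases ht with ht | ht
    · exact Or.inl ⟨by linarith [ht.1], by linarith [ht.2]⟩
    · exact Or.inr ⟨by linarith [ht.1], by linarith [ht.2]⟩
  · rw [coe_add_intCast, coe_add_intCast, h7]
  · rw [coe_add_intCast, coe_add_intCast, h8]

theorem swap (h : Strands γ D p q r s a b c d) : Strands γ D r s p q c d (a + 1) (b + 1) := by
  obtain ⟨h1, h2, h3, h4, h5, h6, h7, h8⟩ := h
  refine ⟨h3, h4, by linarith, by linarith, ?_, ?_, h8, by rw [coe_add_one, coe_add_one, h7]⟩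
  · rw [h5]
    ext x
    constructor
    · rintro ⟨t, ht | ht, rfl⟩
      · exact ⟨t + 1, Or.inr ⟨by linarith [ht.1], by linarith [ht.2]⟩, coe_add_one _⟩
      · exact ⟨t, Or.inl ht, rfl⟩
    · rintro ⟨t, ht | ht, rfl⟩
      · exact ⟨t, Or.inr ht, rfl⟩
      · refine ⟨t - 1, Or.inl ⟨by linarith [ht.1], by linarith [ht.2]⟩, ?_⟩
        simp
  · rintro t (ht | ht)
    · exact h6 t (Or.inr ht)
    · rw [← sub_add_cancel t 1, coe_add_one]
      exact h6 _ (Or.inl ⟨by linarith [ht.1], by linarith [ht.2]⟩)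

/-- Reversing the curve; the second strand is translated so that it follows the first one. -/
theorem neg (h : Strands γ D p q r s a b c d) :
    Strands (fun x => γ (-x)) D p q r s (-b) (-a) (-d + 1) (-c + 1) := by
  obtain ⟨h1, h2, h3, h4, h5, h6, h7, h8⟩ := h
  refine ⟨by linarith, by linarith, by linarith, by linarith, ?_, ?_, ?_, ?_⟩
  · ext x
    have hx : x ∈ (fun x => γ (-x)) ⁻¹' inSphere D ↔ -x ∈ γ ⁻¹' inSphere D := Iff.rfl
    rw [hx, h5]
    constructor
    · rintro ⟨t, ht | ht, e⟩
      · exact ⟨-t, Or.inl ⟨by linarith [ht.2], by linarith [ht.1]⟩, by simp [e]⟩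
      · refine ⟨-t + 1, Or.inr ⟨by linarith [ht.2], by linarith [ht.1]⟩, ?_⟩
        change ((-t + 1 : ℝ) : UnitAddCircle) = x
        rw [coe_add_one]
        simp [e]
    · rintro ⟨t, ht | ht, rfl⟩
      · exact ⟨-t, Or.inl ⟨by linarith [ht.2], by linarith [ht.1]⟩, by simp⟩
      · refine ⟨-t + 1, Or.inr ⟨by linarith [ht.2], by linarith [ht.1]⟩, ?_⟩
        change ((-t + 1 : ℝ) : UnitAddCircle) = _
        rw [coe_add_one]
        simp
  · rintro t (ht | ht)
    · simpa using h6 (-t) (Or.inl ⟨by linarith [ht.2], by linarith [ht.1]⟩)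
    · have := h6 (-t + 1) (Or.inr ⟨by linarith [ht.2], by linarith [ht.1]⟩)
      rw [coe_add_one] at this
      simpa using this
  · simpa [Sym2.eq_swap] using h7
  · rw [coe_add_one, coe_add_one]
    simpa [Sym2.eq_swap] using h8

theorem mem_inSphere (h : Strands γ D p q r s a b c d) {x : ℝ} (hx : x ∈ Icc a b ∪ Icc c d) :
    γ x ∈ inSphere D := by
  have : (x : UnitAddCircle) ∈ γ ⁻¹' inSphere D := by
    rw [h.2.2.2.2.1]
    exact ⟨x, hx, rfl⟩
  exact this

theorem mem_Icc (h : Strands γ D p q r s a b c d) {x : ℝ} (hx : γ x ∈ inSphere D) (h1 : a ≤ x)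
    (h2 : x < a + 1) : x ∈ Icc a b ∪ Icc c d := by
  have hx' : (x : UnitAddCircle) ∈ γ ⁻¹' inSphere D := hx
  rw [h.2.2.2.2.1] at hx'
  obtain ⟨y, hy, e⟩ := hx'
  obtain ⟨k1, k2, k3, k4, -⟩ := h
  have hy' : a ≤ y ∧ y < a + 1 := by
    rcases hy with hy | hy
    · exact ⟨hy.1, by linarith [hy.2]⟩
    · exact ⟨by linarith [hy.1], by linarith [hy.2]⟩
  rwa [← eq_of_coe_eq e (by linarith) (by linarith)]

theorem eq_or_eq (h : Strands γ D p q r s a b c d) :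
    (γ a = p ∧ γ b = q) ∨ (γ a = q ∧ γ b = p) :=
  Sym2.eq_iff.1 h.2.2.2.2.2.2.1

theorem eq_or_eq' (h : Strands γ D p q r s a b c d) :
    (γ c = r ∧ γ d = s) ∨ (γ c = s ∧ γ d = r) :=
  Sym2.eq_iff.1 h.2.2.2.2.2.2.2

/-- A strand meets the boundary of the disk only at its end points. -/
theorem eq_or_eq_of_mem_Icc (h : Strands γ D p q r s a b c d) {x : ℝ} (hx : x ∈ Icc a b)
    (hI : γ x ∉ inSphere (interior D)) : x = a ∨ x = b := by
  by_contra hcon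
  push Not at hcon
  exact hI (h.2.2.2.2.2.1 x (Or.inl ⟨lt_of_le_of_ne hx.1 hcon.1.symm, lt_of_le_of_ne hx.2 hcon.2⟩))

theorem eq_of_eq_left (h : Strands γ D p q r s a b c d) (hq : p ≠ q) (hr : p ≠ r) (hs : p ≠ s)
    (hI : p ∉ interior D) {x y : UnitAddCircle} (hx : γ x = p) (hy : γ y = p) : x = y := by
  have hne : ∀ {z : ℝ × ℝ}, p ≠ z → (p : PlaneInfty) ≠ z := fun h e => h (OnePoint.coe_injective e)
  have hI' : (p : PlaneInfty) ∉ inSphere (interior D) := fun h => hI (coe_mem_inSphere.1 h)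
  obtain ⟨h0, h0', h0'', -⟩ := id h
  have hp : (p : PlaneInfty) ∈ inSphere D := by
    rcases h.eq_or_eq with e | e
    · rw [← e.1]; exact h.mem_inSphere (Or.inl ⟨le_rfl, h0.le⟩)
    · rw [← e.2]; exact h.mem_inSphere (Or.inl ⟨h0.le, le_rfl⟩)
  have key : ∀ x, γ x = p → x = (a : UnitAddCircle) ∨ x = (b : UnitAddCircle) := by
    intro x hx
    have hx' : x ∈ γ ⁻¹' inSphere D := by rw [mem_preimage, hx]; exact hp
    rw [h.2.2.2.2.1] at hx'
    obtain ⟨t, ht | ht, rfl⟩ := hx'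
    · rcases h.eq_or_eq_of_mem_Icc ht (by rw [hx]; exact hI') with rfl | rfl
      · exact Or.inl rfl
      · exact Or.inr rfl
    · exfalso
      rcases h.swap.eq_or_eq_of_mem_Icc ht (by rw [hx]; exact hI') with rfl | rfl <;>
        rcases h.eq_or_eq' with e | e
      · exact hne hr (hx.symm.trans e.1)
      · exact hne hs (hx.symm.trans e.1)
      · exact hne hs (hx.symm.trans e.2)
      · exact hne hr (hx.symm.trans e.2)
  have hab : γ a ≠ γ b := by
    rcases h.eq_or_eq with e | e <;> rw [e.1, e.2]
    · exact hne hq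
    · exact (hne hq).symm
  rcases key x hx with rfl | rfl <;> rcases key y hy with rfl | rfl
  · rfl
  · exact absurd (hx.trans hy.symm) hab
  · exact absurd (hy.trans hx.symm) hab
  · rfl

theorem eq_of_eq (h : Strands γ D p q r s a b c d) (hpq : p ≠ q) (hpr : p ≠ r) (hps : p ≠ s)
    (hqr : q ≠ r) (hqs : q ≠ s) (hrs : r ≠ s) {z : ℝ × ℝ} (hz : z = p ∨ z = q ∨ z = r ∨ z = s)
    (hI : z ∉ interior D) {x y : UnitAddCircle} (hx : γ x = z) (hy : γ y = z) : x = y := by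
  rcases hz with rfl | rfl | rfl | rfl
  · exact h.eq_of_eq_left hpq hpr hps hI hx hy
  · exact h.symm_left.eq_of_eq_left hpq.symm hqr hqs hI hx hy
  · exact h.swap.eq_of_eq_left hrs hpr.symm hqr.symm hI hx hy
  · exact h.swap.symm_left.eq_of_eq_left hrs.symm hps.symm hqs.symm hI hx hy

/-- If the curve arrives at the point `p` on the boundary of the disk, then it continues along
the strand that joins `p` and `q`. -/
theorem exists_of_arrival (h : Strands γ D p q r s a b c d)
    (hu : ∀ x y, γ x = p → γ y = p → x = y) {I : Set PlaneInfty} {e f : ℝ} (hef : e < f)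
    (hI : ∀ x ∈ Ioo e f, γ x ∈ I) (hd : Disjoint I (inSphere (interior D))) (hf : γ f = p) :
    ∃ b' c' d', Strands γ D p q r s f b' c' d' ∧ γ b' = q := by
  rcases h.eq_or_eq with ⟨ea, eb⟩ | ⟨ea, eb⟩
  · obtain ⟨n, rfl⟩ := exists_int_of_coe_eq (hu _ _ ea hf)
    exact ⟨_, _, _, h.shift n, by rw [coe_add_intCast, eb]⟩
  · exact (IsPiece.false_of_right_eq hef h.1 hI (fun x hx => h.2.2.2.2.2.1 x (Or.inl hx)) hd
      (hu _ _ hf eb)).elim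

end Strands

theorem corners_ne {k : ℝ} : nw k ≠ ne k ∧ nw k ≠ sw k ∧ nw k ≠ se k ∧ ne k ≠ sw k ∧
    ne k ≠ se k ∧ sw k ≠ se k := by
  norm_num [nw, sw, ne, se]

theorem corner_not_mem_interior {k : ℝ} {z : ℝ × ℝ}
    (hz : z = nw k ∨ z = ne k ∨ z = sw k ∨ z = se k) :
    z ∉ interior (box k) := by
  rw [interior_box]
  rcases hz with rfl | rfl | rfl | rfl <;> simp [nw, sw, ne, se]

/-- A curve passes through a corner of a tangle only once. -/
theorem IsTangle.eq_of_eq {k : ℝ} (h : IsTangle γ k) {z : ℝ × ℝ}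
    (hz : z = nw k ∨ z = ne k ∨ z = sw k ∨ z = se k) {x y : UnitAddCircle} (hx : γ x = z)
    (hy : γ y = z) : x = y := by
  obtain ⟨h1, h2, h3, h4, h5, h6⟩ := corners_ne (k := k)
  have hI := corner_not_mem_interior hz
  obtain ⟨a, b, c, d, h | h | h⟩ := h
  · exact h.eq_of_eq h1 h2 h3 h4 h5 h6 (by tauto) hI hx hy
  · exact h.eq_of_eq h2 h1 h3 h4.symm h6 h5 (by tauto) hI hx hy
  · exact h.eq_of_eq h3 h2 h1 h6.symm h5.symm h4.symm (by tauto) hI hx hy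

theorem IsCrossing.isTangle {k : ℝ} (h : IsCrossing γ k) : IsTangle γ k := by
  obtain ⟨a, b, c, d, h, -⟩ := h
  exact ⟨a, b, c, d, Or.inr (Or.inr h)⟩

/-- A curve that has tangles in both boxes passes through each of the six corners only once. -/
theorem eq_of_mem_corners (h : IsTangle γ (-1)) (h' : IsTangle γ 0) {z : ℝ × ℝ} (hz : z ∈ corners)
    {x y : UnitAddCircle} (hx : γ x = z) (hy : γ y = z) : x = y := by
  rcases hz with rfl | rfl | rfl | rfl | rfl | rfl
  · exact h.eq_of_eq (by tauto) hx hy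
  · exact h.eq_of_eq (by tauto) hx hy
  · exact h'.eq_of_eq (by tauto) hx hy
  · exact h'.eq_of_eq (by tauto) hx hy
  · exact h'.eq_of_eq (by tauto) hx hy
  · exact h'.eq_of_eq (by tauto) hx hy

/-! ### Reversing a curve -/

theorem IsTangle.neg {k : ℝ} (h : IsTangle γ k) : IsTangle (fun x => γ (-x)) k := by
  obtain ⟨a, b, c, d, h⟩ := h
  exact ⟨_, _, _, _, h.imp Strands.neg (Or.imp Strands.neg Strands.neg)⟩

theorem IsCrossing.neg {k : ℝ} (h : IsCrossing γ k) : IsCrossing (fun x => γ (-x)) k := by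
  obtain ⟨a, b, c, d, h, u, hu, v, hv, huv, hx⟩ := h
  refine ⟨_, _, _, _, h.neg, -u, ⟨by linarith [hu.2], by linarith [hu.1]⟩, -v + 1,
    ⟨by linarith [hv.2], by linarith [hv.1]⟩, ?_, ?_⟩
  · rw [coe_add_one]
    simpa using huv
  · intro x y hxy he hm
    simpa using hx (-x) (-y) (fun h => hxy (neg_injective h)) he hm

theorem SamePart.neg {γ' : UnitAddCircle → PlaneInfty} {A A' : Set PlaneInfty}
    {F : PlaneInfty → PlaneInfty} (h : SamePart γ γ' A A' F) :
    SamePart (fun x => γ (-x)) γ' A A' F := by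
  obtain ⟨φ, h1, h2, h3⟩ := h
  have hm : MapsTo (fun x : UnitAddCircle => -x) ((fun x => γ (-x)) ⁻¹' A) (γ ⁻¹' A) :=
    fun x hx => hx
  refine ⟨fun x => φ (-x), ?_, h2.comp continuous_neg.continuousOn hm, fun t ht => h3 (-t) ht⟩
  refine h1.comp ⟨hm, neg_injective.injOn, fun x hx => ⟨-x, ?_, neg_neg x⟩⟩
  simpa using hx

theorem Standard.neg {γ' : UnitAddCircle → PlaneInfty} (h : Standard γ γ') :
    Standard (fun x => γ (-x)) γ' := by
  obtain ⟨h1, h2, h3, h4, h5, h6⟩ := h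
  exact ⟨h1.neg, h2.neg, h3, h4, h5.neg, h6.neg⟩

/-! ### The order in which a curve runs through crossing, tangle and outside -/

/-- During `[q i, q (i + 1)]` the closed curve `γ` runs from the point `w i` to the point `w (i +
1)` through the region `I i`, and these six arcs make up the whole curve. The end point of the
last arc is `w 0`, in accordance with the addition of `Fin 6`. -/
def RunsThrough {X : Type*} (γ : UnitAddCircle → X) (q : Fin 7 → ℝ) (w : Fin 6 → X)
    (I : Fin 6 → Set X) : Prop :=
  q 6 = q 0 + 1 ∧ ∀ i : Fin 6, q i.castSucc < q i.succ ∧ γ (q i.castSucc) = w i ∧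
    ∀ x ∈ Ioo (q i.castSucc) (q i.succ), γ x ∈ I i

theorem RunsThrough.mk {X : Type*} {γ : UnitAddCircle → X} {q0 q1 q2 q3 q4 q5 : ℝ}
    {w0 w1 w2 w3 w4 w5 : X} {I0 I1 I2 I3 I4 I5 : Set X}
    (h0 : q0 < q1 ∧ γ q0 = w0 ∧ ∀ x ∈ Ioo q0 q1, γ x ∈ I0)
    (h1 : q1 < q2 ∧ γ q1 = w1 ∧ ∀ x ∈ Ioo q1 q2, γ x ∈ I1)
    (h2 : q2 < q3 ∧ γ q2 = w2 ∧ ∀ x ∈ Ioo q2 q3, γ x ∈ I2)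
    (h3 : q3 < q4 ∧ γ q3 = w3 ∧ ∀ x ∈ Ioo q3 q4, γ x ∈ I3)
    (h4 : q4 < q5 ∧ γ q4 = w4 ∧ ∀ x ∈ Ioo q4 q5, γ x ∈ I4)
    (h5 : q5 < q0 + 1 ∧ γ q5 = w5 ∧ ∀ x ∈ Ioo q5 (q0 + 1), γ x ∈ I5) :
    RunsThrough γ ![q0, q1, q2, q3, q4, q5, q0 + 1] ![w0, w1, w2, w3, w4, w5]
      ![I0, I1, I2, I3, I4, I5] := by
  refine ⟨rfl, fun i => ?_⟩
  fin_cases i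
  exacts [h0, h1, h2, h3, h4, h5]

/-- A curve with a crossing in the left box and a tangle in the right box that starts at the upper
left corner in the direction of the crossing runs through the crossing, the tangle and the outside
in one of three possible orders. Here `e` and `e'` are the two right corners, in the order in
which the curve meets them, and `u` and `v` are any parameters on the two strands of the crossing.
-/
theorem exists_runsThrough {u v : ℝ}
    (hK : Strands γ (box (-1)) (nw (-1)) (se (-1)) (sw (-1)) (ne (-1)) a b c d)
    (hu : u ∈ Ioo a b) (hv : v ∈ Ioo c d) (ha : γ a = nw (-1)) (hT : IsTangle γ 0) :
    ∃ e e' : ℝ × ℝ, ((e = ne 0 ∧ e' = se 0) ∨ (e = se 0 ∧ e' = ne 0)) ∧ ∃ q : Fin 7 → ℝ,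
      (RunsThrough γ q ![nw (-1), sw 0, e, sw (-1), nw 0, e']
          ![inner (-1), inner 0, outside, inner (-1), inner 0, outside] ∧
        u ∈ Ioo (q 0) (q 1) ∧ v ∈ Ioo (q 3) (q 4)) ∨
      (RunsThrough γ q ![nw (-1), sw 0, e, e', nw 0, sw (-1)]
          ![inner (-1), inner 0, outside, inner 0, inner (-1), outside] ∧
        u ∈ Ioo (q 0) (q 1) ∧ v ∈ Ioo (q 4) (q 5)) ∨
      (RunsThrough γ q ![nw (-1), sw 0, nw 0, sw (-1), e, e']
          ![inner (-1), inner 0, inner (-1), outside, inner 0, outside] ∧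
        u ∈ Ioo (q 0) (q 1) ∧ v ∈ Ioo (q 2) (q 3)) := by
  have hTK : IsTangle γ (-1) := ⟨a, b, c, d, Or.inr (Or.inr hK)⟩
  have huniq : ∀ {z : ℝ × ℝ}, z ∈ corners → ∀ x y, γ x = z → γ y = z → x = y :=
    fun hz x y hx hy => eq_of_mem_corners hTK hT hz hx hy
  obtain ⟨hab, hbc, hcd, hda, -, hIK, -, -⟩ := id hK
  have hIK1 : ∀ x ∈ Ioo a b, γ x ∈ inner (-1) := fun x hx => hIK x (Or.inl hx)
  have hIK2 : ∀ x ∈ Ioo c d, γ x ∈ inner (-1) := fun x hx => hIK x (Or.inr hx)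
  have cN : nw (-1) ∈ corners := by simp [corners]
  have cS : sw (-1) ∈ corners := by simp [corners]
  have cP : nw 0 ∈ corners := by simp [corners]
  have cM : sw 0 ∈ corners := by simp [corners]
  have cE : ne 0 ∈ corners := by simp [corners]
  have cE' : se 0 ∈ corners := by simp [corners]
  have hN0 : (nw (-1) : PlaneInfty) ∉ inSphere (box 0) := by
    rw [coe_mem_box]; norm_num [nw]
  have hS0 : (sw (-1) : PlaneInfty) ∉ inSphere (box 0) := by
    rw [coe_mem_box]; norm_num [sw]
  rw [ne_neg_one, se_neg_one] at hK
  have hb : γ b = sw 0 := by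
    have := hK.2.2.2.2.2.2.1
    rwa [ha, Sym2.congr_right] at this
  have ha1 : γ ((a + 1 : ℝ) : UnitAddCircle) = nw (-1) := by rw [coe_add_one, ha]
  have hdisj := inner_disjoint_inner
  -- The tangle is described from the strand that leaves the point `sw 0` on.
  have hT' : (∃ e e' : ℝ × ℝ, ((e = ne 0 ∧ e' = se 0) ∨ (e = se 0 ∧ e' = ne 0)) ∧
      ∃ f g h, Strands γ (box 0) (sw 0) e (nw 0) e' b f g h ∧ γ f = e) ∨
      ∃ f g h, Strands γ (box 0) (sw 0) (nw 0) (ne 0) (se 0) b f g h ∧ γ f = nw 0 := by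
    obtain ⟨a', b', c', d', h | h | h⟩ := hT
    · exact Or.inl ⟨se 0, ne 0, Or.inr ⟨rfl, rfl⟩,
        h.swap.exists_of_arrival (huniq cM) hab hIK1 hdisj hb⟩
    · exact Or.inr (h.symm_left.exists_of_arrival (huniq cM) hab hIK1 hdisj hb)
    · exact Or.inl ⟨ne 0, se 0, Or.inl ⟨rfl, rfl⟩,
        h.swap.exists_of_arrival (huniq cM) hab hIK1 hdisj hb⟩
  -- Up to the parameter `a + 1`, what follows the first strand of the tangle is outside unless it
  -- belongs to one of the second strands.
  have hout : ∀ {p q r s : ℝ × ℝ} {f g h : ℝ}, Strands γ (box 0) p q r s b f g h → ∀ x, f < x →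
      x < a + 1 → x ∉ Icc c d → x ∉ Icc g h → γ x ∈ outside := by
    intro p q r s f g h hS x h1 h2 h3 h4
    have := hS.1
    rintro (hx | hx)
    · rcases hK.mem_Icc hx (by linarith) h2 with hx | hx
      · linarith [hx.2]
      · exact h3 hx
    · rcases hS.mem_Icc hx (by linarith) (by linarith) with hx | hx
      · linarith [hx.2]
      · exact h4 hx
  rcases hT' with ⟨e, e', hee, f, g, h, hS, hf⟩ | ⟨f, g, h, hS, hf⟩
  · have hce : e ∈ corners ∧ e' ∈ corners ∧ e ≠ nw 0 := by
      rcases hee with ⟨rfl, rfl⟩ | ⟨rfl, rfl⟩ <;> refine ⟨by assumption, by assumption, ?_⟩ <;>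
        norm_num [ne, se, nw]
    obtain ⟨hbf, hfg, hgh, hhb, -, hIT, -, -⟩ := id hS
    have hIT1 : ∀ x ∈ Ioo b f, γ x ∈ inner 0 := fun x hx => hIT x (Or.inl hx)
    have hIT2 : ∀ x ∈ Ioo g h, γ x ∈ inner 0 := fun x hx => hIT x (Or.inr hx)
    have hfc : f < c := by
      by_contra hcf
      have hc : c ∈ Icc b f := ⟨hbc.le, not_lt.1 hcf⟩
      rcases hK.eq_or_eq' with ⟨ec, -⟩ | ⟨ec, -⟩
      · exact hS0 (ec ▸ hS.mem_inSphere (Or.inl hc))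
      · rcases hS.eq_or_eq_of_mem_Icc hc
          (ec ▸ not_mem_inner_of_mem_corners cP (Or.inr rfl)) with rfl | rfl
        · exact lt_irrefl _ hbc
        · exact hce.2.2 (OnePoint.coe_injective (hf.symm.trans ec))
    refine ⟨e, e', hee, ?_⟩
    rcases hK.eq_or_eq' with ⟨ec, ed⟩ | ⟨ec, ed⟩
    · rcases hS.eq_or_eq' with ⟨eg, eh⟩ | ⟨eg, eh⟩
      · obtain rfl : g = d := eq_of_coe_eq (huniq cP _ _ eg ed) (by linarith) (by linarith)
        have hha : h < a + 1 := by
          by_contra hcon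
          exact hN0 (ha1 ▸ hS.mem_inSphere (Or.inr ⟨hda.le, not_lt.1 hcon⟩))
        refine ⟨_, Or.inl ⟨RunsThrough.mk ⟨hab, ha, hIK1⟩ ⟨hbf, hb, hIT1⟩ ⟨hfc, hf, fun x hx => ?_⟩
          ⟨hcd, ec, hIK2⟩ ⟨hgh, eg, hIT2⟩ ⟨hha, eh, fun x hx => ?_⟩, hu, hv⟩⟩
        · exact hout hS x hx.1 (by linarith [hx.2]) (fun h => by linarith [h.1, hx.2])
            (fun h => by linarith [h.1, hx.2])
        · exact hout hS x (by linarith [hx.1]) hx.2 (fun h => by linarith [h.2, hx.1])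
            (fun h => by linarith [h.2, hx.1])
      · exact (IsPiece.false_of_right_eq hcd hgh hIK2 hIT2 hdisj (huniq cP _ _ ed eh)).elim
    · rcases hS.eq_or_eq' with ⟨eg, eh⟩ | ⟨eg, eh⟩
      · -- Both strands would leave the point `nw 0`.
        have hcg : g = c := eq_of_coe_eq (huniq cP _ _ eg ec) (by linarith) (by linarith)
        subst hcg
        obtain ⟨y, h1, h2⟩ := exists_between (lt_min hcd hgh)
        exact (Set.disjoint_left.1 hdisj (hIK2 y ⟨h1, h2.trans_le (min_le_left _ _)⟩)
          (hIT2 y ⟨h1, h2.trans_le (min_le_right _ _)⟩)).elim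
      · obtain rfl : h = c := eq_of_coe_eq (huniq cP _ _ eh ec) (by linarith) (by linarith)
        refine ⟨_, Or.inr (Or.inl ⟨RunsThrough.mk ⟨hab, ha, hIK1⟩ ⟨hbf, hb, hIT1⟩
          ⟨hfg, hf, fun x hx => ?_⟩ ⟨hgh, eg, hIT2⟩ ⟨hcd, ec, hIK2⟩ ⟨hda, ed, fun x hx => ?_⟩,
          hu, hv⟩)⟩
        · exact hout hS x hx.1 (by linarith [hx.2]) (fun h => by linarith [h.1, hx.2])
            (fun h => by linarith [h.1, hx.2])
        · exact hout hS x (by linarith [hx.1]) hx.2 (fun h => by linarith [h.2, hx.1])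
            (fun h => by linarith [h.2, hx.1])
  · obtain ⟨hbf, hfg, hgh, hhb, -, hIT, -, -⟩ := id hS
    have hIT1 : ∀ x ∈ Ioo b f, γ x ∈ inner 0 := fun x hx => hIT x (Or.inl hx)
    have hIT2 : ∀ x ∈ Ioo g h, γ x ∈ inner 0 := fun x hx => hIT x (Or.inr hx)
    rcases hK.eq_or_eq' with ⟨ec, ed⟩ | ⟨ec, ed⟩
    · exact (IsPiece.false_of_right_eq hcd hbf hIK2 hIT1 hdisj (huniq cP _ _ ed hf)).elim
    obtain rfl : f = c := eq_of_coe_eq (huniq cP _ _ hf ec) (by linarith) (by linarith)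
    have hgd : d < g := by
      by_contra hcon
      have hg0 : γ g ∈ inSphere (box 0) := hS.mem_inSphere (Or.inr ⟨le_rfl, hgh.le⟩)
      rcases (not_lt.1 hcon).eq_or_lt with rfl | hlt
      · exact hS0 (ed ▸ hg0)
      · exact Set.disjoint_left.1 inner_disjoint_box (hIK2 g ⟨hfg, hlt⟩) hg0
    have hha : h < a + 1 := by
      by_contra hcon
      have hh0 : γ h ∈ inSphere (box 0) := hS.mem_inSphere (Or.inr ⟨hgh.le, le_rfl⟩)
      rcases (not_lt.1 hcon).eq_or_lt with rfl | hlt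
      · exact hN0 (ha1 ▸ hh0)
      · refine Set.disjoint_left.1 inner_disjoint_box (hIK1 (h - 1) ⟨by linarith, by linarith⟩) ?_
        rw [← coe_add_one, sub_add_cancel]
        exact hh0
    have hfin : ∀ {e e' : ℝ × ℝ}, γ g = e → γ h = e' → RunsThrough γ ![a, b, f, d, g, h, a + 1]
        ![nw (-1), sw 0, nw 0, sw (-1), e, e']
        ![inner (-1), inner 0, inner (-1), outside, inner 0, outside] := by
      intro e e' eg eh
      refine RunsThrough.mk ⟨hab, ha, hIK1⟩ ⟨hbf, hb, hIT1⟩ ⟨hcd, ec, hIK2⟩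
          ⟨hgd, ed, fun x hx => ?_⟩ ⟨hgh, eg, hIT2⟩ ⟨hha, eh, fun x hx => ?_⟩
      · exact hout hS x (by linarith [hx.1]) (by linarith [hx.2]) (fun h => by linarith [h.2, hx.1])
          (fun h => by linarith [h.1, hx.2])
      · exact hout hS x (by linarith [hx.1]) hx.2 (fun h => by linarith [h.2, hx.1])
          (fun h => by linarith [h.2, hx.1])
    rcases hS.eq_or_eq' with ⟨eg, eh⟩ | ⟨eg, eh⟩
    · exact ⟨ne 0, se 0, Or.inl ⟨rfl, rfl⟩, _, Or.inr (Or.inr ⟨hfin eg eh, hu, hv⟩)⟩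
    · exact ⟨se 0, ne 0, Or.inr ⟨rfl, rfl⟩, _, Or.inr (Or.inr ⟨hfin eg eh, hu, hv⟩)⟩

/-! ### Corresponding arcs and double points in a flype -/

variable {γ' : UnitAddCircle → PlaneInfty}

/-- An arc of `γ` in a part that agrees with a part of `γ'` yields an arc of `γ'`. -/
theorem exists_isPiece_of_bijOn {A A' : Set PlaneInfty} {F : PlaneInfty → PlaneInfty}
    {φ : UnitAddCircle → UnitAddCircle} (hb : BijOn φ (γ ⁻¹' A) (γ' ⁻¹' A'))
    (hc : ContinuousOn φ (γ ⁻¹' A)) (hF : ∀ t ∈ γ ⁻¹' A, γ' (φ t) = F (γ t)) {s t : ℝ}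
    (hst : s < t) (hts : t < s + 1) {I J : Set PlaneInfty} (hI : ∀ x ∈ Ioo s t, γ x ∈ I)
    (hIA : I ⊆ A) (hs : γ s ∈ A) (ht : γ t ∈ A) {z : UnitAddCircle} (hz : γ' z ∉ A')
    (hJ : ∀ y ∈ I, F y ∈ J) :
    ∃ g : ℝ → ℝ, IsPiece γ' J (F (γ s)) (F (γ t)) g s t ∧ ∀ x, (g x : UnitAddCircle) = φ x := by
  have hA : ∀ x ∈ Icc s t, (x : UnitAddCircle) ∈ γ ⁻¹' A := by
    intro x hx
    rcases hx.1.eq_or_lt with rfl | h1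
    · exact hs
    rcases hx.2.eq_or_lt with rfl | h2
    · exact ht
    exact hIA (hI x ⟨h1, h2⟩)
  obtain ⟨g, hg, hi, hφ⟩ := exists_lift_of_continuousOn hts hA hc hb.injOn (z := z)
    (by rintro ⟨x, hx, rfl⟩; exact hz (hb.mapsTo hx))
  refine ⟨g, ⟨hst, hg, hi, ?_, ?_, fun x hx => ?_⟩, hφ⟩
  · rw [hφ, hF _ hs]
  · rw [hφ, hF _ ht]
  · rw [hφ, hF _ (hA x (Ioo_subset_Icc_self hx))]
    exact hJ _ (hI x hx)

theorem exists_isPiece_of_strand {I : Set PlaneInfty} {a b u : ℝ} {p q : PlaneInfty}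
    (hI : ∀ x ∈ Ioo a b, γ x ∈ I) (he : s(γ a, γ b) = s(p, q)) (hu : u ∈ Ioo a b) :
    ∃ g s t, IsPiece γ I p q g s t ∧ ∃ y ∈ Ioo s t, g y = u := by
  have h : IsPiece γ I (γ a) (γ b) id a b :=
    ⟨hu.1.trans hu.2, continuousOn_id, injOn_id _, rfl, rfl, hI⟩
  rcases Sym2.eq_iff.1 he with ⟨rfl, rfl⟩ | ⟨rfl, rfl⟩
  · exact ⟨id, a, b, h, u, hu, rfl⟩
  · exact ⟨_, _, _, h.reverse, -u, ⟨by linarith [hu.2], by linarith [hu.1]⟩, by simp⟩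

theorem turn_coe (z : ℝ × ℝ) : turn z = ((z.1 - 1, -z.2) : ℝ × ℝ) := rfl

theorem turn_injective : Function.Injective turn := by
  refine Option.map_injective fun z w h => ?_
  simp only [Prod.mk.injEq] at h
  exact Prod.ext (by linarith [h.1]) (by linarith [h.2])

theorem turn_mem_inner {z : PlaneInfty} (hz : z ∈ inner 0) : turn z ∈ inner (-1) := by
  obtain ⟨z, hz, rfl⟩ := hz
  rw [interior_box] at hz
  rw [turn_coe, coe_mem_inner]
  obtain ⟨⟨h1, h2⟩, h3, h4⟩ := hz
  refine ⟨⟨?_, ?_⟩, ?_, ?_⟩ <;> simp <;> linarith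

/-- The open rectangle that is covered by the two boxes. -/
def window : Set PlaneInfty := inSphere (Ioo (-1) 1 ×ˢ Ioo (-1) 1)

theorem outside_subset : outside ⊆ windowᶜ := by
  refine compl_subset_compl.2 ?_
  rintro _ ⟨z, ⟨⟨h1, h2⟩, h3, h4⟩, rfl⟩
  rw [mem_union, coe_mem_box, coe_mem_box]
  rcases le_total z.1 0 with h | h
  · exact Or.inl ⟨⟨h1.le, by linarith⟩, h3.le, h4.le⟩
  · exact Or.inr ⟨⟨h, by linarith⟩, h3.le, h4.le⟩

theorem inner_subset_window : inner 0 ⊆ window := by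
  rintro _ ⟨z, hz, rfl⟩
  rw [interior_box] at hz
  obtain ⟨⟨h1, h2⟩, h3, h4⟩ := hz
  exact coe_mem_inSphere.2 ⟨⟨by linarith, by linarith⟩, h3, h4⟩

/-- The double points of `γ` in the set `B` are exactly the point at the parameters `u` and `v`,
which lies in `I`. -/
structure HasSingleCrossing (γ : UnitAddCircle → PlaneInfty) (B I : Set PlaneInfty)
    (u v : UnitAddCircle) : Prop where
  ne : u ≠ v
  eq : γ u = γ v
  mem : γ u ∈ I
  unique : ∀ x y, x ≠ y → γ x = γ y → γ x ∈ B → s(x, y) = s(u, v)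

theorem HasSingleCrossing.symm {B I : Set PlaneInfty} {u v : UnitAddCircle}
    (h : HasSingleCrossing γ B I u v) : HasSingleCrossing γ B I v u :=
  ⟨h.ne.symm, h.eq.symm, h.eq ▸ h.mem, fun x y h1 h2 h3 => by
    rw [h.unique x y h1 h2 h3, Sym2.eq_swap]⟩

theorem IsCrossing.hasSingleCrossing {k : ℝ} (h : IsCrossing γ k)
    (h3 : ∀ x y z, γ x = γ y → γ y = γ z → x = y ∨ y = z ∨ x = z) :
    ∃ a b c d u v : ℝ, Strands γ (box k) (nw k) (se k) (sw k) (ne k) a b c d ∧ u ∈ Ioo a b ∧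
      v ∈ Ioo c d ∧ HasSingleCrossing γ (inSphere (box k)) (inner k) u v := by
  obtain ⟨a, b, c, d, hS, u, hu, v, hv, huv, hx⟩ := h
  obtain ⟨h1, h2, h3', h4, -, h6, -⟩ := id hS
  have hne : (u : UnitAddCircle) ≠ v := fun e => by
    linarith [eq_of_coe_eq e (by linarith [hu.2, hv.1]) (by linarith [hu.1, hv.2]), hu.2, hv.1]
  refine ⟨a, b, c, d, u, v, hS, hu, hv, hne, huv, h6 u (Or.inl hu), fun x y hxy he hm => ?_⟩
  have e1 := hx x y hxy he hm
  have key : ∀ x y : UnitAddCircle, x ≠ y → γ x = γ y → γ x = γ u → x ≠ u →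
      s(x, y) = s((u : UnitAddCircle), (v : UnitAddCircle)) := by
    intro x y hxy he e1 hxu
    have e2 : x = (v : UnitAddCircle) := by
      rcases h3 x u v e1 huv with h | h | h
      · exact absurd h hxu
      · exact absurd h hne
      · exact h
    rcases h3 y x u he.symm e1 with h | h | h
    · exact absurd h.symm hxy
    · exact absurd h hxu
    · rw [e2, h, Sym2.eq_swap]
  by_cases hxu : x = (u : UnitAddCircle)
  · have hyu : y ≠ (u : UnitAddCircle) := fun h => hxy (hxu.trans h.symm)
    rw [Sym2.eq_swap]
    exact key y x hxy.symm he.symm (he.symm.trans e1) hyu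
  · exact key x y hxy he e1 hxu

open Classical in
/-- The correspondence of double points in a flype: the tangle is moved by `φ`, the outside by `ψ`,
and the end points `u`, `v` of the chord of the crossing go to `u'` and `v'`. -/
noncomputable def flypeMap (γ : UnitAddCircle → PlaneInfty) (φ ψ : UnitAddCircle → UnitAddCircle)
    (u u' v' : UnitAddCircle) (x : UnitAddCircle) : UnitAddCircle :=
  if γ x ∈ inSphere (box 0) then φ x
  else if γ x ∈ inSphere (box (-1)) then (if x = u then u' else v') else ψ x

section flypeMap

variable {φ ψ : UnitAddCircle → UnitAddCircle} {u v u' v' : UnitAddCircle}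

theorem flypeMap_of_mem_box {x : UnitAddCircle} (h : γ x ∈ inSphere (box 0)) :
    flypeMap γ φ ψ u u' v' x = φ x := if_pos h

theorem flypeMap_of_mem_outside {x : UnitAddCircle} (h : γ x ∈ outside) :
    flypeMap γ φ ψ u u' v' x = ψ x := by
  rw [flypeMap, if_neg (fun h' => h (Or.inr h')), if_neg (fun h' => h (Or.inl h'))]

theorem flypeMap_left (h : HasSingleCrossing γ (inSphere (box (-1))) (inner (-1)) u v) :
    flypeMap γ φ ψ u u' v' u = u' := by
  rw [flypeMap, if_neg (Set.disjoint_left.1 inner_disjoint_box h.mem),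
    if_pos (inner_subset _ h.mem), if_pos rfl]

theorem flypeMap_right (h : HasSingleCrossing γ (inSphere (box (-1))) (inner (-1)) u v) :
    flypeMap γ φ ψ u u' v' v = v' := by
  rw [flypeMap, if_neg (Set.disjoint_left.1 inner_disjoint_box h.symm.mem),
    if_pos (inner_subset _ h.symm.mem), if_neg h.ne.symm]

theorem bijOn_flypeMap (h : HasSingleCrossing γ (inSphere (box (-1))) (inner (-1)) u v)
    (h' : HasSingleCrossing γ' (inSphere (box 0)) (inner 0) u' v')
    (hφ : BijOn φ (γ ⁻¹' inSphere (box 0)) (γ' ⁻¹' inSphere (box (-1))))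
    (hφF : ∀ t ∈ γ ⁻¹' inSphere (box 0), γ' (φ t) = turn (γ t))
    (hψ : BijOn ψ (γ ⁻¹' windowᶜ) (γ' ⁻¹' windowᶜ))
    (hψF : ∀ t ∈ γ ⁻¹' windowᶜ, γ' (ψ t) = γ t) :
    BijOn (Sym2.map (flypeMap γ φ ψ u u' v')) (doublePairs γ) (doublePairs γ') := by
  have hcases : ∀ z : PlaneInfty, z ∈ inSphere (box 0) ∨ z ∈ inSphere (box (-1)) ∨ z ∈ outside := by
    intro z
    by_cases h1 : z ∈ inSphere (box 0)
    · exact Or.inl h1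
    by_cases h2 : z ∈ inSphere (box (-1))
    · exact Or.inr (Or.inl h2)
    · exact Or.inr (Or.inr fun h => h.elim h2 h1)
  set Φ := flypeMap γ φ ψ u u' v' with hΦ
  have hu : Φ u = u' := flypeMap_left h
  have hv : Φ v = v' := flypeMap_right h
  -- The region of `γ' (Φ x)` determines the region of `γ x`.
  have hreg : ∀ x y, x ≠ y → γ x = γ y →
      (γ x ∈ inSphere (box 0) ∧ Φ x = φ x ∧ γ' (Φ x) ∈ inSphere (box (-1))) ∨
      (x = u ∧ Φ x = u' ∧ γ' (Φ x) ∈ inner 0) ∨ (x = v ∧ Φ x = v' ∧ γ' (Φ x) ∈ inner 0) ∨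
      (γ x ∈ outside ∧ Φ x = ψ x ∧ γ' (Φ x) ∈ outside) := by
    intro x y hxy he
    rcases hcases (γ x) with hx | hx | hx
    · have e : Φ x = φ x := flypeMap_of_mem_box hx
      exact Or.inl ⟨hx, e, e ▸ hφ.mapsTo hx⟩
    · rcases Sym2.eq_iff.1 (h.unique x y hxy he hx) with ⟨rfl, rfl⟩ | ⟨rfl, rfl⟩
      · exact Or.inr (Or.inl ⟨rfl, hu, hu ▸ h'.mem⟩)
      · exact Or.inr (Or.inr (Or.inl ⟨rfl, hv, hv ▸ h'.symm.mem⟩))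
    · have e : Φ x = ψ x := flypeMap_of_mem_outside hx
      refine Or.inr (Or.inr (Or.inr ⟨hx, e, ?_⟩))
      rw [e, hψF x (outside_subset hx)]
      exact hx
  have d1 : ∀ {z z' : PlaneInfty}, z = z' → z ∈ inner 0 → z' ∈ inSphere (box (-1)) → False := by
    rintro z _ rfl h1 h2
    exact Set.disjoint_left.1 inner_disjoint_box' h1 h2
  have d2 : ∀ {z z' : PlaneInfty}, z = z' → z ∈ inner 0 → z' ∈ outside → False := by
    rintro z _ rfl h1 h2
    exact Set.disjoint_left.1 inner_disjoint_outside' h1 h2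
  have d3 : ∀ {z z' : PlaneInfty}, z = z' → z ∈ inSphere (box (-1)) → z' ∈ outside → False := by
    rintro z _ rfl h1 h2
    exact h2 (Or.inl h1)
  refine bijOn_map_doublePairs ?_ ?_ ?_
  · intro x y hxy he
    rcases hcases (γ x) with hx | hx | hx
    · have hy : γ y ∈ inSphere (box 0) := he ▸ hx
      rw [hΦ, flypeMap_of_mem_box hx, flypeMap_of_mem_box hy, hφF x hx, hφF y hy, he]
      exact ⟨fun e => hxy (hφ.injOn hx hy e), rfl⟩
    · rcases Sym2.eq_iff.1 (h.unique x y hxy he hx) with ⟨rfl, rfl⟩ | ⟨rfl, rfl⟩ <;> rw [hu, hv]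
      · exact ⟨h'.ne, h'.eq⟩
      · exact ⟨h'.ne.symm, h'.eq.symm⟩
    · have hy : γ y ∈ outside := he ▸ hx
      rw [hΦ, flypeMap_of_mem_outside hx, flypeMap_of_mem_outside hy,
        hψF x (outside_subset hx), hψF y (outside_subset hy)]
      exact ⟨fun e => hxy (hψ.injOn (outside_subset hx) (outside_subset hy) e), he⟩
  · intro x y x2 y2 hxy he hxy2 he2 e
    rcases hreg x y hxy he with ⟨r, f, m⟩ | ⟨r, f, m⟩ | ⟨r, f, m⟩ | ⟨r, f, m⟩ <;>
      rcases hreg x2 y2 hxy2 he2 with ⟨r2, f2, m2⟩ | ⟨r2, f2, m2⟩ | ⟨r2, f2, m2⟩ | ⟨r2, f2, m2⟩ <;>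
      first
      | exact hφ.injOn r r2 (by rw [← f, ← f2, e])
      | exact r.trans r2.symm
      | exact absurd (f.symm.trans (e.trans f2)) h'.ne
      | exact absurd (f.symm.trans (e.trans f2)) h'.ne.symm
      | exact hψ.injOn (outside_subset r) (outside_subset r2) (by rw [← f, ← f2, e])
      | exact (d1 (congrArg γ' e) m m2).elim
      | exact (d2 (congrArg γ' e) m m2).elim
      | exact (d3 (congrArg γ' e) m m2).elim
      | exact (d1 (congrArg γ' e).symm m2 m).elim
      | exact (d2 (congrArg γ' e).symm m2 m).elim
      | exact (d3 (congrArg γ' e).symm m2 m).elim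
  · intro x' y' hxy he
    rcases hcases (γ' x') with hx | hx | hx
    · rcases Sym2.eq_iff.1 (h'.unique x' y' hxy he hx) with ⟨rfl, rfl⟩ | ⟨rfl, rfl⟩
      · exact ⟨u, v, h.ne, h.eq, by rw [hu, hv]⟩
      · exact ⟨v, u, h.ne.symm, h.eq.symm, by rw [hu, hv]⟩
    · obtain ⟨x, h1, rfl⟩ := hφ.surjOn hx
      obtain ⟨y, h2, rfl⟩ := hφ.surjOn
        (show y' ∈ γ' ⁻¹' inSphere (box (-1)) from (he ▸ hx : γ' y' ∈ _))
      rw [hφF x h1, hφF y h2] at he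
      exact ⟨x, y, fun e => hxy (by rw [e]), turn_injective he, by
        rw [hΦ, flypeMap_of_mem_box h1, flypeMap_of_mem_box h2]⟩
    · obtain ⟨x, h1, rfl⟩ := hψ.surjOn (outside_subset hx)
      obtain ⟨y, h2, rfl⟩ := hψ.surjOn
        (show y' ∈ γ' ⁻¹' windowᶜ from outside_subset (he ▸ hx : γ' y' ∈ outside))
      have hx' := hx
      rw [he] at hx'
      rw [hψF x h1] at hx he
      rw [hψF y h2] at hx' he
      exact ⟨x, y, fun e => hxy (by rw [e]), he, by
        rw [hΦ, flypeMap_of_mem_outside hx, flypeMap_of_mem_outside hx']⟩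

end flypeMap

/-! ### Rearranging the arcs -/

/-- Among the four arcs that do not belong to the crossing, alternately in the tangle (even indices)
and outside (odd indices), the arcs `i` and `j` are both in the tangle or both outside. -/
def SameSide (i j : Fin 4) : Prop :=
  (i = 0 ∨ i = 2) ∧ (j = 0 ∨ j = 2) ∨ (i = 1 ∨ i = 3) ∧ (j = 1 ∨ j = 3)

instance : DecidableRel SameSide := fun i j => by unfold SameSide; infer_instance

/-- How the six arcs of a closed curve are rearranged by a flype: the strands of the crossing are
the arcs `k` and `l` before and the arcs `k'` and `l'` after the move. The other four arcs,
alternately in the tangle and outside, are those with the indices `ι i` before and `ι' i` after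
the move; their order does not change, and the chord of the crossing separates two arcs on the
same side exactly if it did so before. -/
structure Rearrangement (ι ι' : Fin 4 → Fin 6) (k l k' l' : Fin 6) : Prop where
  mono : ∀ i j, i < j → ι i < ι j
  mono' : ∀ i j, i < j → ι' i < ι' j
  lt : k < l
  lt' : k' < l'
  ne : ∀ i, ι i ≠ k ∧ ι i ≠ l
  ne' : ∀ i, ι' i ≠ k' ∧ ι' i ≠ l'
  cover : ∀ i, i = k ∨ i = l ∨ ∃ j, ι j = i
  cover' : ∀ i, i = k' ∨ i = l' ∨ ∃ j, ι' j = i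
  separates : ∀ i j, SameSide i j →
    (((k < ι i ∧ ι i < l) ↔ (k < ι j ∧ ι j < l)) ↔
      ((k' < ι' i ∧ ι' i < l') ↔ (k' < ι' j ∧ ι' j < l')))

theorem lt_iff_of_mem_Ioo {l r : Fin 6 → ℝ} (h : ∀ i j, i < j → r i ≤ l j) {i j : Fin 6} {x y : ℝ}
    (hx : x ∈ Ioo (l i) (r i)) (hy : y ∈ Ioo (l j) (r j)) (hij : i ≠ j) : x < y ↔ i < j := by
  rcases lt_or_gt_of_ne hij with h1 | h1
  · have := h _ _ h1
    exact ⟨fun _ => h1, fun _ => by linarith [hx.2, hy.1]⟩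
  · have := h _ _ h1
    exact ⟨fun _ => by linarith [hx.1, hy.2], fun h2 => absurd h2 h1.not_gt⟩

theorem ne_of_mem_Ioo {l r : Fin 6 → ℝ} (h : ∀ i j, i < j → r i ≤ l j) {i j : Fin 6} {x y : ℝ}
    (hx : x ∈ Ioo (l i) (r i)) (hy : y ∈ Ioo (l j) (r j)) (hij : i ≠ j) : x ≠ y := by
  rintro rfl
  have h1 := lt_iff_of_mem_Ioo h hx hy hij
  have h2 := lt_iff_of_mem_Ioo h hy hx hij.symm
  simp only [lt_irrefl, false_iff] at h1 h2
  omega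

theorem mem_Ioo_iff_of_mem_Ioo {l r : Fin 6 → ℝ} (h : ∀ i j, i < j → r i ≤ l j) {i j k : Fin 6}
    {x u v : ℝ} (hx : x ∈ Ioo (l i) (r i)) (hu : u ∈ Ioo (l j) (r j)) (hv : v ∈ Ioo (l k) (r k))
    (hij : i ≠ j) (hik : i ≠ k) : x ≠ u ∧ x ≠ v ∧ (x ∈ Ioo u v ↔ j < i ∧ i < k) :=
  ⟨ne_of_mem_Ioo h hx hu hij, ne_of_mem_Ioo h hx hv hik,
    and_congr (lt_iff_of_mem_Ioo h hu hx hij.symm) (lt_iff_of_mem_Ioo h hx hv hik)⟩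

namespace RunsThrough

variable {X : Type*} {δ : UnitAddCircle → X} {q : Fin 7 → ℝ} {w : Fin 6 → X} {I : Fin 6 → Set X}

theorem strictMono (h : RunsThrough δ q w I) : StrictMono q :=
  Fin.strictMono_iff_lt_succ.2 fun i => (h.2 i).1

theorem le_of_lt (h : RunsThrough δ q w I) (i j : Fin 6) (hij : i < j) : q i.succ ≤ q j.castSucc :=
  h.strictMono.monotone (by
    rw [Fin.le_def, Fin.val_succ, Fin.val_castSucc]
    exact hij)

theorem zero_le (h : RunsThrough δ q w I) (i : Fin 7) : q 0 ≤ q i :=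
  h.strictMono.monotone (Fin.zero_le _)

theorem le_add_one (h : RunsThrough δ q w I) (i : Fin 7) : q i ≤ q 0 + 1 :=
  h.1 ▸ h.strictMono.monotone (Fin.le_last i)

theorem apply_succ (h : RunsThrough δ q w I) (i : Fin 6) : δ (q i.succ) = w (i + 1) := by
  have h0 : δ (q 6) = w 0 := by
    rw [h.1, coe_add_one]
    exact (h.2 0).2.1
  fin_cases i
  exacts [(h.2 1).2.1, (h.2 2).2.1, (h.2 3).2.1, (h.2 4).2.1, (h.2 5).2.1, h0]

theorem exists_mem_Ioo (h : RunsThrough δ q w I) {x : UnitAddCircle} (hx : ∀ i, δ x ≠ w i) :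
    ∃ i : Fin 6, ∃ y ∈ Ioo (q i.castSucc) (q i.succ), (y : UnitAddCircle) = x := by
  obtain ⟨y, h1, h2, rfl⟩ := exists_lift (q 0) x
  by_contra hcon
  have key : ∀ i : Fin 7, q i ≤ y := by
    intro i
    induction i using Fin.induction with
    | zero => exact h1
    | succ i hi =>
      by_contra hlt
      rcases hi.eq_or_lt with he | hi
      · exact hx i (he ▸ (h.2 i).2.1)
      · exact hcon ⟨i, y, ⟨hi, not_le.1 hlt⟩, rfl⟩
  linarith [key 6, h.1]

end RunsThrough

/-- The double points of two curves correspond to each other in such a way that crossing chords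
correspond to crossing chords. -/
def DoublePairsEquiv (γ γ' : UnitAddCircle → PlaneInfty) : Prop :=
  ∃ f, BijOn f (doublePairs γ) (doublePairs γ') ∧
    ∀ c ∈ doublePairs γ, ∀ d ∈ doublePairs γ, Cross c d ↔ Cross (f c) (f d)

/-- If the arcs of `γ` are rearranged to arcs that lead from each of the points `w' i` to the next
one, then these arcs fit together to the curve `γ'`, and the intersection graph is preserved. Here
`w i` and `I i` are the starting point and the region of the `i`-th arc of `γ`, and `w' i` and
`I' i` those of the `i`-th arc of `γ'`. -/
theorem doublePairsEquiv_of_rearrangement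
    (h3' : ∀ x y z, γ' x = γ' y → γ' y = γ' z → x = y ∨ y = z ∨ x = z)
    (hst : Standard γ γ') {u v : ℝ}
    (huv : HasSingleCrossing γ (inSphere (box (-1))) (inner (-1)) u v)
    {q : Fin 7 → ℝ} {w w' : Fin 6 → PlaneInfty} {I I' : Fin 6 → Set PlaneInfty}
    {ι ι' : Fin 4 → Fin 6} {k l k' l' : Fin 6} (hι : Rearrangement ι ι' k l k' l')
    (hq : RunsThrough γ q w I) (hu : u ∈ Ioo (q k.castSucc) (q k.succ))
    (hv : v ∈ Ioo (q l.castSucc) (q l.succ))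
    (hw : ∀ i, w i ∈ inSphere corners) (hw' : ∀ i, w' i ∈ inSphere corners)
    (hwi : ∀ i, i ≠ 0 → w' i ≠ w' 0)
    (hI' : ∀ i, I' i = inner (-1) ∨ I' i = inner 0 ∨ I' i = outside)
    (hII : ∀ i, Disjoint (I' i) (I' (i + 1)))
    (hT : ∀ i, i = 0 ∨ i = 2 → I (ι i) = inner 0 ∧ I' (ι' i) = inner (-1) ∧
      w (ι i) ∈ inSphere (box 0) ∧ w (ι i + 1) ∈ inSphere (box 0) ∧
      w' (ι' i) = turn (w (ι i)) ∧ w' (ι' i + 1) = turn (w (ι i + 1)))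
    (hO : ∀ i, i = 1 ∨ i = 3 → I (ι i) = outside ∧ I' (ι' i) = outside ∧
      w (ι i) ∈ windowᶜ ∧ w (ι i + 1) ∈ windowᶜ ∧
      w' (ι' i) = w (ι i) ∧ w' (ι' i + 1) = w (ι i + 1))
    (hK : I k = inner (-1) ∧ I l = inner (-1) ∧ I' k' = inner 0 ∧ I' l' = inner 0)
    (hK' : (s(w' k', w' (k' + 1)) = s(↑(nw 0), ↑(se 0)) ∧
        s(w' l', w' (l' + 1)) = s(↑(sw 0), ↑(ne 0))) ∨
      (s(w' k', w' (k' + 1)) = s(↑(sw 0), ↑(ne 0)) ∧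
        s(w' l', w' (l' + 1)) = s(↑(nw 0), ↑(se 0)))) :
    DoublePairsEquiv γ γ' := by
  obtain ⟨hc, ht, ht', hc', ⟨φ, hφ, hφc, hφF⟩, ⟨ψ, hψ, hψc, hψF⟩⟩ := hst
  have huniq : ∀ i x y, γ x = w i → γ y = w i → x = y := by
    intro i x y hx hy
    obtain ⟨z, hz, e⟩ := hw i
    exact eq_of_mem_corners hc.isTangle ht hz (hx.trans e.symm) (hy.trans e.symm)
  have huniq' : ∀ i x y, γ' x = w' i → γ' y = w' i → x = y := by
    intro i x y hx hy
    obtain ⟨z, hz, e⟩ := hw' i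
    exact eq_of_mem_corners ht' hc'.isTangle hz (hx.trans e.symm) (hy.trans e.symm)
  -- The two strands of the crossing of `γ'`, in the order in which they are used
  obtain ⟨U, V, hUV, ⟨gk, sk, tk, hk, yk, hyk, ek⟩, ⟨gl, sl, tl, hl, yl, hyl, el⟩⟩ :
      ∃ U V : UnitAddCircle, HasSingleCrossing γ' (inSphere (box 0)) (inner 0) U V ∧
        (∃ g s t, IsPiece γ' (inner 0) (w' k') (w' (k' + 1)) g s t ∧
          ∃ y ∈ Ioo s t, (g y : UnitAddCircle) = U) ∧
        (∃ g s t, IsPiece γ' (inner 0) (w' l') (w' (l' + 1)) g s t ∧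
          ∃ y ∈ Ioo s t, (g y : UnitAddCircle) = V) := by
    obtain ⟨a, b, c, d, x, y, hS, hx, hy, hxy⟩ := hc'.hasSingleCrossing h3'
    have i1 : ∀ x ∈ Ioo a b, γ' x ∈ inner 0 := fun x hx => hS.2.2.2.2.2.1 x (Or.inl hx)
    have i2 : ∀ x ∈ Ioo c d, γ' x ∈ inner 0 := fun x hx => hS.2.2.2.2.2.1 x (Or.inr hx)
    have e1 := hS.2.2.2.2.2.2.1
    have e2 := hS.2.2.2.2.2.2.2
    rcases hK' with ⟨f1, f2⟩ | ⟨f1, f2⟩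
    · obtain ⟨g, s, t, hg, z, hz, ez⟩ := exists_isPiece_of_strand i1 (e1.trans f1.symm) hx
      obtain ⟨g', s', t', hg', z', hz', ez'⟩ := exists_isPiece_of_strand i2 (e2.trans f2.symm) hy
      exact ⟨x, y, hxy, ⟨g, s, t, hg, z, hz, by rw [ez]⟩, ⟨g', s', t', hg', z', hz', by rw [ez']⟩⟩
    · obtain ⟨g, s, t, hg, z, hz, ez⟩ := exists_isPiece_of_strand i2 (e2.trans f1.symm) hy
      obtain ⟨g', s', t', hg', z', hz', ez'⟩ := exists_isPiece_of_strand i1 (e1.trans f2.symm) hx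
      exact ⟨y, x, hxy.symm, ⟨g, s, t, hg, z, hz, by rw [ez]⟩,
        ⟨g', s', t', hg', z', hz', by rw [ez']⟩⟩
  set Φ := flypeMap γ φ ψ u U V with hΦ
  have hΦu : Φ u = U := flypeMap_left huv
  have hΦv : Φ v = V := flypeMap_right huv
  refine ⟨Sym2.map Φ, bijOn_flypeMap huv hUV hφ hφF hψ hψF, ?_⟩
  have hinj' : ∀ i j, ι' i = ι' j → i = j := by
    intro i j hij
    rcases lt_trichotomy i j with h | h | h
    · exact absurd hij (hι.mono' _ _ h).ne
    · exact h
    · exact absurd hij (hι.mono' _ _ h).ne'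
  have hside : ∀ i : Fin 4, (i = 0 ∨ i = 2) ∨ (i = 1 ∨ i = 3) := by decide
  -- Every arc of `γ` in the tangle or outside yields an arc of `γ'`.
  have hmove : ∀ i, ∃ g, IsPiece γ' (I' (ι' i)) (w' (ι' i)) (w' (ι' i + 1)) g
      (q (ι i).castSucc) (q (ι i).succ) ∧
      ∀ x ∈ Ioo (q (ι i).castSucc) (q (ι i).succ), (g x : UnitAddCircle) = Φ x := by
    intro i
    obtain ⟨h1, h2, h5⟩ := hq.2 (ι i)
    have h4 := hq.apply_succ (ι i)
    have hlt : q (ι i).succ < q (ι i).castSucc + 1 := by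
      have e1 := hq.zero_le (ι i).castSucc
      have e2 := hq.le_add_one (ι i).succ
      refine lt_of_le_of_ne (by linarith) fun e => ?_
      -- An arc of full length would leave no room for the crossing.
      have e3 : q (ι i).castSucc = q 0 := by linarith
      have e4 : q (ι i).succ = q 0 + 1 := by linarith
      have e5 := hq.zero_le k.castSucc
      have e6 := hq.le_add_one k.succ
      exact ne_of_mem_Ioo (l := fun i => q i.castSucc) (r := fun i => q i.succ) hq.le_of_lt
        (i := ι i) (j := k) (x := u) (y := u) ⟨by linarith [hu.1], by linarith [hu.2]⟩ hu
        (hι.ne i).1 rfl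
    rcases hside i with hi | hi
    · obtain ⟨a1, a2, a3, a4, a5, a6⟩ := hT i hi
      rw [a1] at h5
      obtain ⟨g, hg, hgφ⟩ := exists_isPiece_of_bijOn hφ hφc hφF h1 hlt h5 (inner_subset 0)
        (h2 ▸ a3) (h4 ▸ a4) (z := U) (Set.disjoint_left.1 inner_disjoint_box' hUV.mem)
        (fun y hy => turn_mem_inner hy)
      rw [h2, h4] at hg
      rw [a2, a5, a6]
      exact ⟨g, hg, fun x hx => by
        rw [hgφ, hΦ, flypeMap_of_mem_box (inner_subset 0 (h5 x hx))]⟩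
    · obtain ⟨a1, a2, a3, a4, a5, a6⟩ := hO i hi
      rw [a1] at h5
      obtain ⟨g, hg, hgφ⟩ := exists_isPiece_of_bijOn (F := id) hψ hψc hψF h1 hlt h5 outside_subset
        (h2 ▸ a3) (h4 ▸ a4) (z := U) (fun h => h (inner_subset_window hUV.mem))
        (fun y hy => hy)
      rw [h2, h4] at hg
      rw [a2, a5, a6]
      exact ⟨g, hg, fun x hx => by
        rw [hgφ, hΦ, flypeMap_of_mem_outside (h5 x hx)]⟩
  have hpiece : ∀ i, ∃ g s t, IsPiece γ' (I' i) (w' i) (w' (i + 1)) g s t ∧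
      (∀ j, ι' j = i → s = q (ι j).castSucc ∧ t = q (ι j).succ ∧
        ∀ x ∈ Ioo s t, (g x : UnitAddCircle) = Φ x) ∧
      (i = k' → ∃ y ∈ Ioo s t, (g y : UnitAddCircle) = U) ∧
      (i = l' → ∃ y ∈ Ioo s t, (g y : UnitAddCircle) = V) := by
    intro i
    rcases hι.cover' i with rfl | rfl | ⟨j, rfl⟩
    · rw [hK.2.2.1]
      exact ⟨gk, sk, tk, hk, fun j hj => absurd hj (hι.ne' j).1, fun _ => ⟨yk, hyk, ek⟩,
        fun h => absurd h hι.lt'.ne⟩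
    · rw [hK.2.2.2]
      exact ⟨gl, sl, tl, hl, fun j hj => absurd hj (hι.ne' j).2, fun h => absurd h hι.lt'.ne',
        fun _ => ⟨yl, hyl, el⟩⟩
    · obtain ⟨g, hg, hg'⟩ := hmove j
      refine ⟨g, _, _, hg, fun j' hj' => ?_, fun h => absurd h (hι.ne' j).1,
        fun h => absurd h (hι.ne' j).2⟩
      obtain rfl := hinj' _ _ hj'
      exact ⟨rfl, rfl, hg'⟩
  choose g s t hg hgι hgk hgl using hpiece
  obtain ⟨σ, hσ, h, hgh, hmono, hle, h0, h1⟩ := IsPiece.exists_cycle hg hII huniq' hwi (by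
    intro i hi
    obtain ⟨z, hz, e⟩ := hw' 0
    rw [← e] at hi
    rcases hI' i with h | h | h <;> rw [h] at hi
    · exact not_mem_inner_of_mem_corners hz (Or.inl rfl) hi
    · exact not_mem_inner_of_mem_corners hz (Or.inr rfl) hi
    · exact not_mem_outside_of_mem_corners hz hi)
  have hσc : ∀ c d, Cross (c.map σ) (d.map σ) ↔ Cross c d := by
    intro c d
    rcases hσ with rfl | rfl
    · rw [Sym2.map_id, id, id]
    · exact Cross.map_neg_iff
  obtain ⟨yu, hyu, eu⟩ := hgk k' rfl
  obtain ⟨yv, hyv, ev⟩ := hgl l' rfl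
  have hmem : ∀ i, ∀ x ∈ Ioo (s i) (t i), h i x ∈ Ioo (h i (s i)) (h i (t i)) := fun i x hx =>
    have hst := (hx.1.trans hx.2).le
    ⟨hmono i (left_mem_Icc.2 hst) (Ioo_subset_Icc_self hx) hx.1,
      hmono i (Ioo_subset_Icc_self hx) (right_mem_Icc.2 hst) hx.2⟩
  have hs : ∀ j, s (ι' j) = q (ι j).castSucc := fun j => (hgι _ j rfl).1
  have ht : ∀ j, t (ι' j) = q (ι j).succ := fun j => (hgι _ j rfl).2.1
  have mu := hmem k' yu hyu
  have mv := hmem l' yv hyv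
  have hkl : u < v := (lt_iff_of_mem_Ioo (l := fun i => q i.castSucc) (r := fun i => q i.succ)
    hq.le_of_lt hu hv hι.lt.ne).2 hι.lt
  have hkl' : h k' yu < h l' yv := (lt_iff_of_mem_Ioo (l := fun i => h i (s i))
    (r := fun i => h i (t i)) hle mu mv hι.lt'.ne).2 hι.lt'
  refine cross_map_iff hσc (z := q 0) (z' := h 0 (s 0)) (u := u) (v := v) (u' := h k' yu)
    (v' := h l' yv) (l := fun i => q (ι i).castSucc) (r := fun i => q (ι i).succ)
    (h := fun i => h (ι' i)) (k := fun i => k < ι i ∧ ι i < l)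
    (k' := fun i => k' < ι' i ∧ ι' i < l') (J := SameSide)
    ((hq.zero_le _).trans hu.1.le) hkl (hv.2.trans_le (hq.le_add_one _))
    ((h0 _).trans mu.1.le) hkl' (mv.2.trans_le (h1 _))
    (fun i => hq.zero_le _) (fun i => hq.le_add_one _)
    (fun i j hij => hq.le_of_lt _ _ (hι.mono i j hij))
    (fun i => hs i ▸ h0 (ι' i)) (fun i => ht i ▸ h1 (ι' i))
    (fun i j hij => hs j ▸ ht i ▸ hle _ _ (hι.mono' i j hij))
    (fun i => hs i ▸ ht i ▸ hmono (ι' i)) ?_ ?_ ?_ ?_ ?_ (fun i j hij => hι.separates i j hij) ?_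
  · intro i x hx
    rw [hgh, (hgι _ i rfl).2.2 x (by rw [hs, ht]; exact hx)]
  · rw [hgh, eu, hΦu]
  · rw [hgh, ev, hΦv]
  · intro i x hx
    exact mem_Ioo_iff_of_mem_Ioo (l := fun i => q i.castSucc) (r := fun i => q i.succ)
      hq.le_of_lt hx hu hv (hι.ne i).1 (hι.ne i).2
  · intro i x hx
    exact mem_Ioo_iff_of_mem_Ioo (l := fun i => h i (s i)) (r := fun i => h i (t i))
      hle (hmem _ x (by rw [hs, ht]; exact hx)) mu mv (hι.ne' i).1 (hι.ne' i).2
  · -- The chords of `γ` are the chord of the crossing and chords between arcs on the same side.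
    have hloc : ∀ x y, x ≠ y → γ x = γ y → s(x, y) = s((u : UnitAddCircle), (v : UnitAddCircle)) ∨
        ∃ i, ∃ z ∈ Ioo (q (ι i).castSucc) (q (ι i).succ), (z : UnitAddCircle) = x := by
      intro x y hxy he
      obtain ⟨i, z, hz, rfl⟩ := hq.exists_mem_Ioo
        (fun i hi => hxy (huniq i x y hi (he.symm.trans hi)))
      have hzI := (hq.2 i).2.2 z hz
      rcases hι.cover i with rfl | rfl | ⟨j, rfl⟩
      · rw [hK.1] at hzI
        exact Or.inl (huv.unique _ _ hxy he (inner_subset _ hzI))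
      · rw [hK.2.1] at hzI
        exact Or.inl (huv.unique _ _ hxy he (inner_subset _ hzI))
      · exact Or.inr ⟨j, z, hz, rfl⟩
    rintro _ ⟨x, y, hxy, he, rfl⟩
    rcases hloc x y hxy he with h | ⟨i, z, hz, rfl⟩
    · exact Or.inl h
    rcases hloc y _ hxy.symm he.symm with h | ⟨j, z', hz', rfl⟩
    · exact Or.inl (Sym2.eq_swap.trans h)
    right
    have hzI := (hq.2 _).2.2 z hz
    have hzI' := (hq.2 _).2.2 z' hz'
    have hij : SameSide i j := by
      rcases hside i with hi | hi <;> rcases hside j with hj | hj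
      · exact Or.inl ⟨hi, hj⟩
      · rw [(hT i hi).1] at hzI
        rw [(hO j hj).1] at hzI'
        exact (Set.disjoint_left.1 inner_disjoint_outside' hzI (he ▸ hzI')).elim
      · rw [(hO i hi).1] at hzI
        rw [(hT j hj).1] at hzI'
        exact (Set.disjoint_left.1 inner_disjoint_outside' hzI' (he ▸ hzI)).elim
      · exact Or.inr ⟨hi, hj⟩
    rcases lt_trichotomy z z' with h | rfl | h
    · exact ⟨i, j, hij, z, hz, z', hz', h, rfl⟩
    · exact absurd rfl hxy
    · exact ⟨j, i, hij.imp And.symm And.symm, z', hz', z, hz, h, Sym2.eq_swap⟩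

theorem turn_nw : turn (nw 0) = sw (-1) := by rw [turn_coe]; norm_num [nw, sw]
theorem turn_sw : turn (sw 0) = nw (-1) := by rw [turn_coe]; norm_num [nw, sw]
theorem turn_ne : turn (ne 0) = sw 0 := by rw [turn_coe]; norm_num [ne, sw]
theorem turn_se : turn (se 0) = nw 0 := by rw [turn_coe]; norm_num [se, nw]

/-! ### The three possible orders -/

/-- The flype from the order crossing, tangle, outside, crossing, tangle, outside to the order
tangle, crossing, outside, tangle, crossing, outside. -/
theorem rearrangement_ctocto : Rearrangement ![1, 2, 4, 5] ![0, 2, 3, 5] 0 3 1 4 := by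
  constructor <;> decide

/-- The flype from the order crossing, tangle, outside, tangle, crossing, outside to the order
tangle, crossing, outside, crossing, tangle, outside. -/
theorem rearrangement_ctotco : Rearrangement ![1, 2, 3, 5] ![0, 2, 4, 5] 0 4 1 3 := by
  constructor <;> decide

/-- The flype from the order crossing, tangle, crossing, outside, tangle, outside to the order
tangle, outside, crossing, tangle, crossing, outside. -/
theorem rearrangement_ctcoto : Rearrangement ![1, 3, 4, 5] ![0, 1, 3, 5] 0 2 2 4 := by
  constructor <;> decide

theorem coe_mem_compl_window {z : ℝ × ℝ} (h : z = nw (-1) ∨ z = sw (-1) ∨ z = ne 0 ∨ z = se 0) :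
    (z : PlaneInfty) ∈ windowᶜ := by
  rw [mem_compl_iff, window, coe_mem_inSphere]
  rcases h with rfl | rfl | rfl | rfl <;> norm_num [nw, sw, ne, se]

theorem coe_mem_box_zero {z : ℝ × ℝ} (h : z = nw 0 ∨ z = sw 0 ∨ z = ne 0 ∨ z = se 0) :
    (z : PlaneInfty) ∈ inSphere (box 0) := by
  rw [coe_mem_box]
  rcases h with rfl | rfl | rfl | rfl <;> norm_num [nw, sw, ne, se]

theorem forall_fin_six {p : Fin 6 → Prop} (h0 : p 0) (h1 : p 1) (h2 : p 2) (h3 : p 3) (h4 : p 4)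
    (h5 : p 5) (i : Fin 6) : p i := by
  fin_cases i
  exacts [h0, h1, h2, h3, h4, h5]

/-- The case of a curve that enters the crossing at the upper left corner. The circle of `γ'` is
read from the same corner on, into the tangle. -/
theorem doublePairsEquiv_of_apply_eq
    (h3' : ∀ x y z, γ' x = γ' y → γ' y = γ' z → x = y ∨ y = z ∨ x = z)
    (hst : Standard γ γ') {a b c d u v : ℝ}
    (hS : Strands γ (box (-1)) (nw (-1)) (se (-1)) (sw (-1)) (ne (-1)) a b c d)
    (hu : u ∈ Ioo a b) (hv : v ∈ Ioo c d)
    (huv : HasSingleCrossing γ (inSphere (box (-1))) (inner (-1)) u v) (ha : γ a = nw (-1)) :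
    DoublePairsEquiv γ γ' := by
  have cN : (nw (-1) : PlaneInfty) ∈ inSphere corners := coe_mem_inSphere.2 (by simp [corners])
  have cS : (sw (-1) : PlaneInfty) ∈ inSphere corners := coe_mem_inSphere.2 (by simp [corners])
  have cP : (nw 0 : PlaneInfty) ∈ inSphere corners := coe_mem_inSphere.2 (by simp [corners])
  have cM : (sw 0 : PlaneInfty) ∈ inSphere corners := coe_mem_inSphere.2 (by simp [corners])
  have bP : (nw 0 : PlaneInfty) ∈ inSphere (box 0) := coe_mem_box_zero (by tauto)
  have bM : (sw 0 : PlaneInfty) ∈ inSphere (box 0) := coe_mem_box_zero (by tauto)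
  have oN : (nw (-1) : PlaneInfty) ∈ windowᶜ := coe_mem_compl_window (by tauto)
  have oS : (sw (-1) : PlaneInfty) ∈ windowᶜ := coe_mem_compl_window (by tauto)
  have nS : (sw (-1) : PlaneInfty) ≠ nw (-1) := fun h => by
    have := OnePoint.coe_injective h
    norm_num [sw, nw] at this
  obtain ⟨e, e', hee, q, hq⟩ := exists_runsThrough hS hu hv ha hst.2.1
  have hee' : e ∈ corners ∧ e' ∈ corners ∧ (e = ne 0 ∨ e = se 0) ∧ (e' = ne 0 ∨ e' = se 0) := by
    rcases hee with ⟨rfl, rfl⟩ | ⟨rfl, rfl⟩ <;> simp [corners]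
  obtain ⟨cE, cE', he, he'⟩ := hee'
  replace cE : (e : PlaneInfty) ∈ inSphere corners := coe_mem_inSphere.2 cE
  replace cE' : (e' : PlaneInfty) ∈ inSphere corners := coe_mem_inSphere.2 cE'
  have bE : (e : PlaneInfty) ∈ inSphere (box 0) := coe_mem_box_zero (by tauto)
  have bE' : (e' : PlaneInfty) ∈ inSphere (box 0) := coe_mem_box_zero (by tauto)
  have oE : (e : PlaneInfty) ∈ windowᶜ := coe_mem_compl_window (by tauto)
  have oE' : (e' : PlaneInfty) ∈ windowᶜ := coe_mem_compl_window (by tauto)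
  have ht : ∀ {z : ℝ × ℝ}, z = ne 0 ∨ z = se 0 → turn z ∈ inSphere corners ∧
      turn z ≠ nw (-1) ∧ (z : PlaneInfty) ≠ nw (-1) := by
    rintro z (rfl | rfl)
    · rw [turn_ne]
      refine ⟨cM, fun h => ?_, fun h => ?_⟩ <;> have := OnePoint.coe_injective h <;>
        norm_num [sw, nw, ne] at this
    · rw [turn_se]
      refine ⟨cP, fun h => ?_, fun h => ?_⟩ <;> have := OnePoint.coe_injective h <;>
        norm_num [se, nw] at this
  obtain ⟨cF, nF, nE⟩ := ht he
  obtain ⟨cF', nF', nE'⟩ := ht he'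
  have hpair : (s(turn e, (e : PlaneInfty)) = s(↑(nw 0), ↑(se 0)) ∧
        s(turn e', (e' : PlaneInfty)) = s(↑(sw 0), ↑(ne 0))) ∨
      (s(turn e, (e : PlaneInfty)) = s(↑(sw 0), ↑(ne 0)) ∧
        s(turn e', (e' : PlaneInfty)) = s(↑(nw 0), ↑(se 0))) := by
    rcases hee with ⟨rfl, rfl⟩ | ⟨rfl, rfl⟩ <;> rw [turn_ne, turn_se]
    · exact Or.inr ⟨rfl, rfl⟩
    · exact Or.inl ⟨rfl, rfl⟩
  have d1 := inner_disjoint_inner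
  have d2 := inner_disjoint_outside
  have d3 := inner_disjoint_outside'
  rcases hq with ⟨hq, hu, hv⟩ | ⟨hq, hu, hv⟩ | ⟨hq, hu, hv⟩
  · refine doublePairsEquiv_of_rearrangement h3' hst huv rearrangement_ctocto hq hu hv
      (w' := ![nw (-1), turn e, e, sw (-1), turn e', e'])
      (I' := ![inner (-1), inner 0, outside, inner (-1), inner 0, outside])
      (forall_fin_six cN cM cE cS cP cE') (forall_fin_six cN cF cE cS cF' cE')
      (forall_fin_six (fun h => absurd rfl h) (fun _ => nF) (fun _ => nE) (fun _ => nS)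
        (fun _ => nF') (fun _ => nE'))
      (forall_fin_six (.inl rfl) (.inr (.inl rfl)) (.inr (.inr rfl)) (.inl rfl) (.inr (.inl rfl))
        (.inr (.inr rfl)))
      (forall_fin_six d1 d3 d2.symm d1 d3 d2.symm) ?_ ?_ ⟨rfl, rfl, rfl, rfl⟩ hpair
    · rintro _ (rfl | rfl)
      · exact ⟨rfl, rfl, bM, bE, turn_sw.symm, rfl⟩
      · exact ⟨rfl, rfl, bP, bE', turn_nw.symm, rfl⟩
    · rintro _ (rfl | rfl)
      · exact ⟨rfl, rfl, oE, oS, rfl, rfl⟩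
      · exact ⟨rfl, rfl, oE', oN, rfl, rfl⟩
  · refine doublePairsEquiv_of_rearrangement h3' hst huv rearrangement_ctotco hq hu hv
      (w' := ![nw (-1), turn e, e, e', turn e', sw (-1)])
      (I' := ![inner (-1), inner 0, outside, inner 0, inner (-1), outside])
      (forall_fin_six cN cM cE cE' cP cS) (forall_fin_six cN cF cE cE' cF' cS)
      (forall_fin_six (fun h => absurd rfl h) (fun _ => nF) (fun _ => nE) (fun _ => nE')
        (fun _ => nF') (fun _ => nS))
      (forall_fin_six (.inl rfl) (.inr (.inl rfl)) (.inr (.inr rfl)) (.inr (.inl rfl)) (.inl rfl)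
        (.inr (.inr rfl)))
      (forall_fin_six d1 d3 d3.symm d1.symm d2 d2.symm) ?_ ?_ ⟨rfl, rfl, rfl, rfl⟩
      (by rw [Sym2.eq_swap (a := turn e')] at hpair; exact hpair)
    · rintro _ (rfl | rfl)
      · exact ⟨rfl, rfl, bM, bE, turn_sw.symm, rfl⟩
      · exact ⟨rfl, rfl, bE', bP, rfl, turn_nw.symm⟩
    · rintro _ (rfl | rfl)
      · exact ⟨rfl, rfl, oE, oE', rfl, rfl⟩
      · exact ⟨rfl, rfl, oS, oN, rfl, rfl⟩
  · refine doublePairsEquiv_of_rearrangement h3' hst huv rearrangement_ctcoto hq hu hv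
      (w' := ![nw (-1), sw (-1), e, turn e, turn e', e'])
      (I' := ![inner (-1), outside, inner 0, inner (-1), inner 0, outside])
      (forall_fin_six cN cM cP cS cE cE') (forall_fin_six cN cS cE cF cF' cE')
      (forall_fin_six (fun h => absurd rfl h) (fun _ => nS) (fun _ => nE) (fun _ => nF)
        (fun _ => nF') (fun _ => nE'))
      (forall_fin_six (.inl rfl) (.inr (.inr rfl)) (.inr (.inl rfl)) (.inl rfl) (.inr (.inl rfl))
        (.inr (.inr rfl)))
      (forall_fin_six d2 d3.symm d1.symm d1 d3 d2.symm) ?_ ?_ ⟨rfl, rfl, rfl, rfl⟩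
      (by rw [Sym2.eq_swap (a := turn e)] at hpair; exact hpair)
    · rintro _ (rfl | rfl)
      · exact ⟨rfl, rfl, bM, bP, turn_sw.symm, turn_nw.symm⟩
      · exact ⟨rfl, rfl, bE, bE', rfl, rfl⟩
    · rintro _ (rfl | rfl)
      · exact ⟨rfl, rfl, oS, oE, rfl, rfl⟩
      · exact ⟨rfl, rfl, oE', oN, rfl, rfl⟩

/-! ### Invariance under flypes -/

theorem DoublePairsEquiv.of_neg (h : DoublePairsEquiv (fun x => γ (-x)) γ') :
    DoublePairsEquiv γ γ' := by
  obtain ⟨f, hf, hc⟩ := h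
  have hm : ∀ {δ : UnitAddCircle → PlaneInfty}, MapsTo (Sym2.map fun x => -x) (doublePairs δ)
      (doublePairs fun x => δ (-x)) := by
    rintro δ _ ⟨x, y, hxy, he, rfl⟩
    exact ⟨-x, -y, fun e => hxy (neg_injective e), by simpa using he, rfl⟩
  have hinv : ∀ c : Sym2 UnitAddCircle, (c.map fun x => -x).map (fun x => -x) = c := by
    intro c
    simp [Sym2.map_map]
  refine ⟨fun c => f (c.map fun x => -x), hf.comp ⟨hm, ?_, ?_⟩, fun c hc1 d hd1 => ?_⟩
  · exact fun c _ d _ e => by rw [← hinv c, e, hinv]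
  · intro c hc1
    refine ⟨c.map fun x => -x, ?_, hinv c⟩
    simpa using hm hc1
  · rw [← hc _ (hm hc1) _ (hm hd1), Cross.map_neg_iff]

/-- A flype in standard position preserves the intersection graph of the chord diagram. -/
theorem Standard.doublePairsEquiv
    (h3 : ∀ x y z, γ x = γ y → γ y = γ z → x = y ∨ y = z ∨ x = z)
    (h3' : ∀ x y z, γ' x = γ' y → γ' y = γ' z → x = y ∨ y = z ∨ x = z)
    (hst : Standard γ γ') : DoublePairsEquiv γ γ' := by
  obtain ⟨a, b, c, d, u, v, hS, hu, hv, huv⟩ := hst.1.hasSingleCrossing h3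
  rcases hS.eq_or_eq with ⟨ha, -⟩ | ⟨-, hb⟩
  · exact doublePairsEquiv_of_apply_eq h3' hst hS hu hv huv ha
  · -- The reversed curve starts at the upper left corner.
    refine DoublePairsEquiv.of_neg (doublePairsEquiv_of_apply_eq (u := -u) (v := -v + 1)
      h3' hst.neg hS.neg ⟨by linarith [hu.2], by linarith [hu.1]⟩
      ⟨by linarith [hv.2], by linarith [hv.1]⟩ ?_ (by simpa using hb))
    rw [coe_add_one]
    refine ⟨fun e => huv.ne (by simpa using e), by simpa using huv.eq, by simpa using huv.mem,
      fun x y hxy he hm => ?_⟩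
    have := huv.unique (-x) (-y) (fun e => hxy (neg_injective e)) he hm
    simpa [Sym2.eq_iff, neg_eq_iff_eq_neg] using this

end Flype

theorem mainTheorem5 (P P' : KnotProjection) (h : IsFlype P P') : P.lam = P'.lam := by
  obtain ⟨Φ, Φ', hst⟩ := h
  obtain ⟨f, hf, hc⟩ := hst.doublePairsEquiv
    (fun x y z hxy hyz => P.no_triple x y z (Φ.injective hxy) (Φ.injective hyz))
    (fun x y z hxy hyz => P'.no_triple x y z (Φ'.injective hxy) (Φ'.injective hyz))
  have e : doublePairs (fun t => Φ (P.curve t)) = P.chordDiagram.chords := by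
    simp only [doublePairs, EmbeddingLike.apply_eq_iff_eq]
    rfl
  have e' : doublePairs (fun t => Φ' (P'.curve t)) = P'.chordDiagram.chords := by
    simp only [doublePairs, EmbeddingLike.apply_eq_iff_eq]
    rfl
  rw [e, e'] at hf
  rw [e] at hc
  obtain ⟨h1, h2, h3⟩ := ChordDiagram.counts_eq_of_bijOn hf hc
  rw [KnotProjection.lam, KnotProjection.lam, KnotProjection.hCount, KnotProjection.hCount,
    KnotProjection.tripleCount, KnotProjection.tripleCount, KnotProjection.crossCount,
    KnotProjection.crossCount, h1, h2, h3]
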